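/- **Theorem.** Let $I=[0,1)$, $a_n=\frac1{100n^3}$ $(n\ge 1)$ and $N=4$. Put $I_n=\big[4\sum_{k=1}^{n-1}a_k,\;4\sum_{k=1}^{n}a_k\big)$, let $I_n^{(1)}$ and $I_n^{(2)}$ be its left and right halves (of length $2a_n$), let $J=\big[4\sum_{k\ge1}a_k,\,1\big)$, and cut $J$ into $N$ half-open intervals $J_1,\dots,J_N$ of equal length. Let $v_n:I\to I_n^{(1)}$ and $w_n:I\to I_n^{(2)}$ be the maps that send $0$ to the left end point of their target and have derivatives $$v_n'(x)=a_n\big(1+2\cos^2(2\pi n^4x)\big),\qquad w_n'(x)=a_n\big(1+2\sin^2(2\pi n^4x)\big),$$ and let $T:I\to I$ be the map whose inverse branches are the maps $v_n,w_n$ $(n\ge1)$ and the increasing affine bijections $I\to J_j$ $(1\le j\le N)$. Let $\mathcal L f(x)=\sum_{T(y)=x} f(y)/T'(y)$, where $T'$ is the derivative from the right. Then: 1. $T$ is a well-defined uniformly expanding Markov map with (infinitely many) full branches: the intervals $I_n^{(1)},I_n^{(2)},J_j$ form a partition of $I$, each of them is the bijective image of $I$ under the corresponding inverse branch, these branches have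 the derivatives prescribed above (the constant $|J|/N$ for the affine ones), and there is $\kappa>1$ with $T'\ge\kappa$ on $I$. 2. $T$ preserves Lebesgue measure, and $\mathcal L$ is its transfer operator: for every integrable $f:I\to\mathbb C$ the function $\mathcal Lf$ is integrable, and $\int f\cdot g\circ T\,dx=\int \mathcal L f\cdot g\,dx$ for every bounded measurable $g:I\to\mathbb C$. 3. $\mathcal L$ acts as a bounded operator on the space $\mathrm{Lip}$ of Lipschitz functions $f:I\to\mathbb C$ with the norm $\|f\|_{\mathrm{Lip}}=\sup|f|+\sup_{x\ne y}|f(x)-f(y)|/|x-y|$, and it has a spectral gap there: its essential spectral radius (the supremum of $|z|$ over the $z\in\mathbb C$ for which $z-\mathcal L$ is not Fredholm) is at most $3/4$; $1$ is an eigenvalue of algebraic multiplicity one; there is no other eigenvalue of modulus $1$; and there is $r<1$ such that the spectrum of $\mathcal L$ is contained in $\{1\}\cup\{|z|\le r\}$. 4. For every $k\ge1$, $\mathcal L^k$ does not act continuously on the space of functions of bounded variation: there is no finite $C$ such that $\|\mathcal L^kf\|_{\mathcal{BV}}\le C\|f\|_{\mathcal{BV}}$ for all $f$ with $\|f\|_{\mathcal{BV}}<\infty$.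 This holds both for functions defined everywhere, with $\|f\|_{\mathcal{BV}}=\sup|f|+\mathrm{Var}(f)$, and for classes of functions modulo equality almost everywhere, with $\|f\|_{\mathcal{BV}}=\|f\|_{L^1}+\inf\{\mathrm{Var}(g): g=f\text{ a.e.}\}$. -/

import Mathlib

open MeasureTheory
open scoped ENNReal NNReal

noncomputable section

namespace LipGap

/-- The interval `I = [0,1)`; its measure is Lebesgue measure (the subtype measure `volume`). -/
abbrev I : Type := ↥(Set.Ico (0 : ℝ) 1)

instance : MeasureSpace I := Measure.Subtype.measureSpace

/-! ### The interval map -/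

/-- Labels of the inverse branches: the pairs `v n`, `w n` (`n ≥ 1`) and `N` affine ones. -/
inductive Branch (N : ℕ) : Type
  | v (n : ℕ+) : Branch N
  | w (n : ℕ+) : Branch N
  | affine (j : Fin N) : Branch N

/-- The left end point `4 ∑_{k=1}^{n-1} a_k` of the interval `I_n`. -/
def leftEnd (a : ℕ → ℝ) (n : ℕ) : ℝ := 4 * ∑ k ∈ Finset.Ico 1 n, a k

/-- The left end point `4 ∑_{k≥1} a_k` of the interval `J = [4 ∑ a_k, 1)`. -/
def leftEndJ (a : ℕ → ℝ) : ℝ := 4 * ∑' n : ℕ+, a n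

/-- The left end point of the image of a branch: `I_n` is cut into two halves, and `J` into `N`
intervals of the same length. -/
def left (a : ℕ → ℝ) (N : ℕ) : Branch N → ℝ
  | .v n => leftEnd a n
  | .w n => leftEnd a n + 2 * a n
  | .affine j => leftEndJ a + (j : ℕ) * ((1 - leftEndJ a) / N)

/-- The length of the image of a branch. -/
def length (a : ℕ → ℝ) (N : ℕ) : Branch N → ℝ
  | .v n => 2 * a n
  | .w n => 2 * a n
  | .affine _ => (1 - leftEndJ a) / N

/-- The image of a branch: `I_n^{(1)}` for `v n`, `I_n^{(2)}` for `w n`, and the `N` pieces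
of `J` for the affine branches. -/
def piece (a : ℕ → ℝ) (N : ℕ) (b : Branch N) : Set ℝ :=
  Set.Ico (left a N b) (left a N b + length a N b)

/-- The prescribed derivative of a branch. -/
def branchDeriv (a : ℕ → ℝ) (N : ℕ) : Branch N → ℝ → ℝ
  | .v n, x => a n * (1 + 2 * Real.cos (2 * Real.pi * (n : ℝ) ^ 4 * x) ^ 2)
  | .w n, x => a n * (1 + 2 * Real.sin (2 * Real.pi * (n : ℝ) ^ 4 * x) ^ 2)
  | .affine _, _ => (1 - leftEndJ a) / N

/-- The inverse branch with the prescribed derivative that starts at the left end of its image. -/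
def branch (a : ℕ → ℝ) (N : ℕ) (b : Branch N) (x : ℝ) : ℝ :=
  left a N b + ∫ t in (0 : ℝ)..x, branchDeriv a N b t

instance (N : ℕ) : Nonempty (Branch N × I) := ⟨(.v 1, ⟨0, by simp⟩)⟩

/-- The map `T`: if `y = branch b x` with `x ∈ I`, then `T y = x`. -/
def intervalMap (a : ℕ → ℝ) (N : ℕ) (y : I) : I :=
  (Function.invFun (fun p : Branch N × I => branch a N p.1 p.2) (y : ℝ)).2

/-- The derivative `T'(y)`, taken from the right (so that it makes sense at the left end points
of the intervals of the partition as well). -/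
def rightDeriv (T : I → I) (y : I) : ℝ :=
  derivWithin (Function.extend Subtype.val (fun z : I => (T z : ℝ)) 0) (Set.Ico (y : ℝ) 1) y

/-- The transfer operator `f ↦ (x ↦ ∑_{T y = x} f y / T'(y))`. -/
def transfer (T : I → I) (f : I → ℂ) (x : I) : ℂ :=
  ∑' y : {y : I // T y = x}, f y / (rightDeriv T y : ℂ)

/-! ### The Banach space of Lipschitz functions -/

/-- The linear space of complex Lipschitz functions on `I`. -/
def lipSubmodule : Submodule ℂ (I → ℂ) where
  carrier := {f | ∃ K : ℝ≥0, LipschitzWith K f}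
  add_mem' := by
    rintro f g ⟨K, hK⟩ ⟨K', hK'⟩
    exact ⟨K + K', hK.add hK'⟩
  zero_mem' := ⟨0, LipschitzWith.const 0⟩
  smul_mem' := by
    rintro c f ⟨K, hK⟩
    refine ⟨‖c‖₊ * K, LipschitzWith.of_dist_le_mul fun x y => ?_⟩
    have h := hK.dist_le_mul x y
    simp only [Pi.smul_apply, dist_eq_norm, ← smul_sub, norm_smul] at h ⊢
    calc ‖c‖ * ‖f x - f y‖ ≤ ‖c‖ * (K * dist x y) := by gcongr
      _ = _ := by push_cast; rw [mul_assoc]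

/-- The type of complex Lipschitz functions on `I`. -/
def Lip : Type := ↥lipSubmodule

instance : AddCommGroup Lip := inferInstanceAs (AddCommGroup ↥lipSubmodule)
instance : Module ℂ Lip := inferInstanceAs (Module ℂ ↥lipSubmodule)
instance : CoeFun Lip (fun _ => I → ℂ) := ⟨fun f => f.1⟩

/-- The best Lipschitz constant `sup |f x - f y| / |x - y|`. -/
def lipConst (f : I → ℂ) : ℝ := ⨆ p : I × I, ‖f p.1 - f p.2‖ / dist p.1 p.2

/-- The norm `sup |f| + Lip(f)`. -/
instance : Norm Lip := ⟨fun f => (⨆ x : I, ‖f x‖) + lipConst f⟩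

instance : Nonempty I := ⟨⟨0, by simp⟩⟩

lemma Lip.norm_def (f : Lip) : ‖f‖ = (⨆ x : I, ‖f x‖) + lipConst f := rfl

lemma Lip.add_apply (f g : Lip) (x : I) : (f + g) x = f x + g x := rfl

lemma Lip.smul_apply (c : ℂ) (f : Lip) (x : I) : (c • f) x = c * f x := rfl

lemma Lip.bddAbove_lip (f : Lip) :
    BddAbove (Set.range fun p : I × I => ‖f p.1 - f p.2‖ / dist p.1 p.2) := by
  obtain ⟨K, hK⟩ := f.2
  refine ⟨K, ?_⟩
  rintro _ ⟨p, rfl⟩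
  have h := hK.dist_le_mul p.1 p.2
  rw [dist_eq_norm] at h
  exact div_le_of_le_mul₀ dist_nonneg K.2 h

lemma Lip.bddAbove_sup (f : Lip) : BddAbove (Set.range fun x : I => ‖f x‖) := by
  obtain ⟨K, hK⟩ := f.2
  let z : I := ⟨0, by simp⟩
  refine ⟨‖f z‖ + K, ?_⟩
  rintro _ ⟨x, rfl⟩
  have h := hK.dist_le_mul x z
  have hx : dist x z ≤ 1 := by
    rw [Subtype.dist_eq, Real.dist_eq]
    have h0 := x.2.1
    have h1 := x.2.2
    rw [abs_le]
    constructor <;> simp [z] <;> linarith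
  rw [dist_eq_norm] at h
  have h2 : ‖f x‖ ≤ ‖f z‖ + ‖f x - f z‖ := by
    simpa using norm_add_le (f z) (f x - f z)
  have h3 : (K : ℝ) * dist x z ≤ K * 1 := by gcongr
  change ‖f x‖ ≤ _
  linarith

lemma Lip.core : NormedSpace.Core ℂ Lip where
  norm_nonneg f := add_nonneg (Real.iSup_nonneg fun _ => norm_nonneg _)
    (Real.iSup_nonneg fun _ => div_nonneg (norm_nonneg _) dist_nonneg)
  norm_smul c f := by
    simp only [Lip.norm_def, lipConst, Lip.smul_apply, ← mul_sub, norm_mul, mul_div_assoc]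
    rw [← Real.mul_iSup_of_nonneg (norm_nonneg c), ← Real.mul_iSup_of_nonneg (norm_nonneg c),
      mul_add]
  norm_triangle f g := by
    have h1 : (⨆ x : I, ‖(f + g) x‖) ≤ (⨆ x : I, ‖f x‖) + ⨆ x : I, ‖g x‖ :=
      ciSup_le fun x => (norm_add_le _ _).trans
        (add_le_add (le_ciSup f.bddAbove_sup x) (le_ciSup g.bddAbove_sup x))
    have h2 : lipConst ((f + g : Lip) : I → ℂ) ≤ lipConst f + lipConst g := by
      refine ciSup_le fun p => ?_
      refine le_trans ?_ (add_le_add (le_ciSup f.bddAbove_lip p) (le_ciSup g.bddAbove_lip p))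
      rw [← add_div]
      refine div_le_div_of_nonneg_right ?_ dist_nonneg
      have : (f + g) p.1 - (f + g) p.2 = (f p.1 - f p.2) + (g p.1 - g p.2) := by
        simp only [Lip.add_apply]; ring
      exact this ▸ norm_add_le _ _
    simp only [Lip.norm_def]
    linarith
  norm_eq_zero_iff f := by
    constructor
    · intro h
      have h2 : 0 ≤ lipConst f := Real.iSup_nonneg fun _ => div_nonneg (norm_nonneg _) dist_nonneg
      rw [Lip.norm_def] at h
      apply Subtype.ext
      funext x
      have h3 : ‖f x‖ ≤ ⨆ x : I, ‖f x‖ := le_ciSup f.bddAbove_sup x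
      have h4 := norm_nonneg (f x)
      exact norm_eq_zero.1 (by linarith)
    · rintro rfl
      have : ∀ x, (0 : Lip) x = 0 := fun _ => rfl
      simp [Lip.norm_def, lipConst, this]

instance : NormedAddCommGroup Lip := NormedAddCommGroup.ofCore Lip.core
instance : NormedSpace ℂ Lip := NormedSpace.ofCore Lip.core

/-! ### Essential spectrum -/

/-- The essential spectral radius of a bounded operator: the supremum of `|z|` over the essential
spectrum, i.e. over the `z` for which `z - A` is not a Fredholm operator. -/
def essSpectralRadius {E : Type*} [NormedAddCommGroup E] [NormedSpace ℂ E] (A : E →L[ℂ] E) :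
    ℝ≥0∞ :=
  ⨆ z ∈ {z : ℂ | ¬ (z • ContinuousLinearMap.id ℂ E - A).IsFredholm}, ‖z‖ₑ

/-! ### Bounded variation -/

/-- The norm `sup |f| + Var(f)` (infinite exactly when `f` is not of bounded variation). -/
def bvNorm (f : I → ℂ) : ℝ≥0∞ := (⨆ x : I, ‖f x‖ₑ) + eVariationOn f Set.univ

/-- The norm of the space of classes (modulo equality almost everywhere) of functions of bounded
variation: the `L¹` norm plus the least variation of a function that is almost everywhere equal
to `f` (infinite exactly when the class of `f` is not of bounded variation). -/
def essBVNorm (f : I → ℂ) : ℝ≥0∞ :=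
  (∫⁻ x : I, ‖f x‖ₑ) + ⨅ (g : I → ℂ) (_ : f =ᵐ[volume] g), eVariationOn g Set.univ

/-- The operator `P` maps the space of functions of finite norm `ν` continuously to itself. -/
def ActsContinuously (ν : (I → ℂ) → ℝ≥0∞) (P : (I → ℂ) → (I → ℂ)) : Prop :=
  ∃ C : ℝ≥0, ∀ f : I → ℂ, ν f < ∞ → ν (P f) ≤ C * ν f

end LipGap

end

open LipGap

namespace LipGap

/-! By the double-angle formulas `v_n' = a_n (2 + cos(4π n⁴ x))` and `w_n' = a_n (2 - cos(4π n⁴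
x))`. The oscillations cancel in the sum `v_n' + w_n' = 4 a_n`, so the derivatives of all inverse
branches add up to `1`. Hence Lebesgue measure is preserved and the constant function `1` is fixed
by the transfer operator `L`.

Taken alone, the weight `v_n'` has Lipschitz constant `4π n⁴ a_n`, of order `n`, which is not
summable. In the pair, however, the variation of `v_n'` is multiplied only by `f(v_n y) - f(w_n y)`,
which is at most `4 a_n` times the Lipschitz constant of `f`. The product is of order `n⁴ a_n² ~
n⁻²`, with a small sum. The four affine branches contribute at most `1/4`, so `L` at least halves
Lipschitz constants (`IsWeight.norm_transfer_sub_le`). On functions of mean zero the Lipschitz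
constant controls the norm; removing the rank-one projection onto constants therefore leaves an
operator whose powers are at most `2 · 2⁻ⁿ` (`IsWeight.norm_pow_le`). The spectral gap follows by
pure operator theory (`spectralGap_of_pow_le`).

In bounded variation no such cancellation is forced: the indicator of the image of `v_n` sees only
one member of the pair, and `L` sends it to `v_n'`, whose variation is of order `n⁴ a_n ~ n`, while
the indicator has norm at most `3`. Pulling the indicator back through an affine branch `k` times
gives the same for `L^(k+1)`, up to a factor independent of `n`
(`IsWeight.iterate_transfer_nestedPiece`). The oscillation is visible on sets of positive measure,
so changing the function on a null set does not help (`IsWeight.le_eVariationOn`). -/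

/-- The weights of the map: `a n = 1 / (100 n³)` for `n ≥ 1`. -/
def IsWeight (a : ℕ → ℝ) : Prop := ∀ n : ℕ, 1 ≤ n → a n = 1 / (100 * (n : ℝ) ^ 3)

/-! ### The weights `a_n` and the end points of the intervals `I_n`. -/

section Weights

variable {a : ℕ → ℝ} (ha : IsWeight a)

include ha in
lemma IsWeight.eq (n : ℕ+) : a n = 1 / (100 * (n : ℝ) ^ 3) := ha n n.2

lemma one_le_pnat (n : ℕ+) : (1 : ℝ) ≤ n := by exact_mod_cast n.2

include ha in
lemma IsWeight.pos (n : ℕ+) : 0 < a n := by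
  have := one_le_pnat n
  rw [ha.eq]; positivity

include ha in
lemma IsWeight.le (n : ℕ+) : a n ≤ 1 / 100 := by
  rw [ha.eq]
  have h : (1 : ℝ) ≤ (n : ℝ) ^ 3 := one_le_pow₀ (one_le_pnat n)
  rw [div_le_div_iff₀ (by positivity) (by norm_num)]
  linarith

lemma hasSum_one_div_pnat_sq : HasSum (fun n : ℕ+ => 1 / (n : ℝ) ^ 2) (Real.pi ^ 2 / 6) := by
  have h := hasSum_zeta_two
  rw [← Function.Injective.hasSum_iff PNat.coe_injective] at h
  · exact h
  · intro x hx
    have : x = 0 := by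
      by_contra h0
      exact hx ⟨⟨x, Nat.pos_of_ne_zero h0⟩, rfl⟩
    simp [this]

lemma pi_sq_div_six_le_two : Real.pi ^ 2 / 6 ≤ 2 := by
  nlinarith [Real.pi_lt_d2, Real.pi_pos]

-- Comparison with `1/n²` is lossy but enough: its sum `π²/6 ≤ 2` is explicit, and it serves both
-- the size of `J` and the contraction estimate.
include ha in
lemma IsWeight.le_inv_sq (n : ℕ+) : a n ≤ 1 / 100 * (1 / (n : ℝ) ^ 2) := by
  have h1 := one_le_pnat n
  rw [ha.eq, div_mul_div_comm, one_mul]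
  apply one_div_le_one_div_of_le (by positivity)
  gcongr
  norm_num

include ha in
lemma IsWeight.summable : Summable fun n : ℕ+ => a n :=
  Summable.of_nonneg_of_le (fun n => (ha.pos n).le) ha.le_inv_sq
    (hasSum_one_div_pnat_sq.summable.mul_left _)

include ha in
lemma IsWeight.leftEndJ_le : leftEndJ a ≤ 8 / 100 := by
  have h : ∑' n : ℕ+, a n ≤ 1 / 100 * (Real.pi ^ 2 / 6) := by
    rw [← hasSum_one_div_pnat_sq.tsum_eq, ← tsum_mul_left]
    exact ha.summable.tsum_le_tsum ha.le_inv_sq (hasSum_one_div_pnat_sq.summable.mul_left _)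
  have := pi_sq_div_six_le_two
  unfold leftEndJ
  linarith

include ha in
lemma IsWeight.leftEndJ_pos : 0 < leftEndJ a := by
  have := ha.summable.tsum_pos (fun n => (ha.pos n).le) 1 (ha.pos 1)
  unfold leftEndJ
  linarith

lemma leftEnd_one : leftEnd a 1 = 0 := by simp [leftEnd]

lemma leftEnd_succ (n : ℕ) (hn : 1 ≤ n) : leftEnd a (n + 1) = leftEnd a n + 4 * a n := by
  rw [leftEnd, Finset.sum_Ico_succ_top hn, leftEnd, mul_add]

include ha in
lemma IsWeight.hasSum_succ : HasSum (fun n : ℕ => 4 * a (n + 1)) (leftEndJ a) := by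
  have h := ha.summable.hasSum
  rw [← Equiv.pnatEquivNat.symm.hasSum_iff] at h
  exact h.mul_left 4

lemma leftEnd_succ_eq_sum (n : ℕ) : leftEnd a (n + 1) = ∑ k ∈ Finset.range n, 4 * a (k + 1) := by
  rw [leftEnd, Finset.sum_Ico_eq_sum_range, Finset.mul_sum]
  simp [add_comm]

include ha in
lemma IsWeight.tendsto_leftEnd :
    Filter.Tendsto (fun n => leftEnd a (n + 1)) Filter.atTop (nhds (leftEndJ a)) := by
  simp_rw [leftEnd_succ_eq_sum]
  exact ha.hasSum_succ.tendsto_sum_nat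

include ha in
lemma IsWeight.monotone_leftEnd : StrictMono (fun n => leftEnd a (n + 1)) := by
  refine strictMono_nat_of_lt_succ fun n => ?_
  have := ha.pos ⟨n + 1, n.succ_pos⟩
  simp only [PNat.mk_coe] at this
  rw [leftEnd_succ (n + 1) (by omega)]
  linarith

include ha in
lemma IsWeight.leftEnd_le_leftEndJ (n : ℕ) : leftEnd a (n + 1) ≤ leftEndJ a :=
  ha.monotone_leftEnd.monotone.ge_of_tendsto ha.tendsto_leftEnd n

lemma pnat_succ (n : ℕ+) : ((n : ℕ) - 1) + 1 = n := Nat.sub_add_cancel n.2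

include ha in
lemma IsWeight.leftEnd_nonneg (n : ℕ+) : 0 ≤ leftEnd a n := by
  have := ha.monotone_leftEnd.monotone (Nat.zero_le ((n : ℕ) - 1))
  simpa only [pnat_succ, zero_add, leftEnd_one] using this

include ha in
lemma IsWeight.leftEnd_add_le (n : ℕ+) : leftEnd a n + 4 * a n ≤ leftEndJ a := by
  rw [← leftEnd_succ n n.2]
  exact ha.leftEnd_le_leftEndJ n

include ha in
lemma IsWeight.leftEnd_add_le_of_lt {m n : ℕ+} (h : m < n) :
    leftEnd a m + 4 * a m ≤ leftEnd a n := by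
  rw [← leftEnd_succ m m.2]
  have h' : (m : ℕ) < n := h
  have := ha.monotone_leftEnd.monotone (show (m : ℕ) ≤ n - 1 by omega)
  simpa only [pnat_succ] using this

end Weights

/-! ### The images of the branches partition `[0,1)`. -/

section Partition

variable {a : ℕ → ℝ} (ha : IsWeight a)

include ha in
lemma IsWeight.length_pos (b : Branch 4) : 0 < length a 4 b := by
  cases b with
  | v n => exact mul_pos two_pos (ha.pos n)
  | w n => exact mul_pos two_pos (ha.pos n)
  | affine j =>
    have := ha.leftEndJ_le
    simp only [length, Nat.cast_ofNat]
    linarith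

include ha in
lemma IsWeight.disjoint_piece :
    Pairwise fun b b' : Branch 4 => Disjoint (piece a 4 b) (piece a 4 b') := by
  have hJ := ha.leftEndJ_le
  have key : ∀ (m n : ℕ+) (y : ℝ), leftEnd a m ≤ y → y < leftEnd a m + 4 * a m →
      leftEnd a n ≤ y → y < leftEnd a n + 4 * a n → m = n := by
    intro m n y h1 h2 h3 h4
    rcases lt_trichotomy m n with h | h | h
    · linarith [ha.leftEnd_add_le_of_lt h]
    · exact h
    · linarith [ha.leftEnd_add_le_of_lt h]
  have keyJ : ∀ (i j : Fin 4) (y : ℝ), left a 4 (.affine i) ≤ y →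
      y < left a 4 (.affine i) + length a 4 (.affine i) → left a 4 (.affine j) ≤ y →
      y < left a 4 (.affine j) + length a 4 (.affine j) → i = j := by
    intro i j y h1 h2 h3 h4
    simp only [left, length, Nat.cast_ofNat] at h1 h2 h3 h4
    have hd : 0 < (1 - leftEndJ a) / 4 := by linarith
    have e1 : ((i : ℕ) : ℝ) < (j : ℕ) + 1 := by nlinarith
    have e2 : ((j : ℕ) : ℝ) < (i : ℕ) + 1 := by nlinarith
    have e1' : (i : ℕ) < j + 1 := by exact_mod_cast e1
    have e2' : (j : ℕ) < i + 1 := by exact_mod_cast e2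
    exact Fin.ext (by omega)
  have keyL : ∀ (j : Fin 4), leftEndJ a ≤ left a 4 (.affine j) := by
    intro j
    simp only [left, Nat.cast_ofNat]
    have : (0 : ℝ) ≤ (j : ℕ) * ((1 - leftEndJ a) / 4) :=
      mul_nonneg (Nat.cast_nonneg _) (by linarith)
    linarith
  intro b b' hb
  rw [Set.disjoint_left]
  rintro y ⟨h1, h2⟩ ⟨h3, h4⟩
  apply hb
  cases b with
  | v m =>
    have := ha.pos m
    have := ha.leftEnd_add_le m
    cases b' with
    | v n =>
      have := ha.pos n
      simp only [left, length] at h1 h2 h3 h4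
      rw [key m n y] <;> linarith
    | w n =>
      have := ha.pos n
      simp only [left, length] at h1 h2 h3 h4
      obtain rfl : m = n := by apply key m n y <;> linarith
      linarith
    | affine j =>
      simp only [left, length] at h1 h2
      linarith [keyL j]
  | w m =>
    have := ha.pos m
    have := ha.leftEnd_add_le m
    cases b' with
    | v n =>
      have := ha.pos n
      simp only [left, length] at h1 h2 h3 h4
      obtain rfl : m = n := by apply key m n y <;> linarith
      linarith
    | w n =>
      have := ha.pos n
      simp only [left, length] at h1 h2 h3 h4
      rw [key m n y] <;> linarith
    | affine j =>
      simp only [left, length] at h1 h2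
      linarith [keyL j]
  | affine i =>
    cases b' with
    | v n =>
      have := ha.pos n
      have := ha.leftEnd_add_le n
      simp only [left, length] at h3 h4
      linarith [keyL i]
    | w n =>
      have := ha.pos n
      have := ha.leftEnd_add_le n
      simp only [left, length] at h3 h4
      linarith [keyL i]
    | affine j => rw [keyJ i j y h1 h2 h3 h4]

include ha in
lemma IsWeight.iUnion_piece : (⋃ b : Branch 4, piece a 4 b) = Set.Ico (0 : ℝ) 1 := by
  have hJ := ha.leftEndJ_le
  have hJ0 := ha.leftEndJ_pos
  ext y
  simp only [Set.mem_iUnion, piece, Set.mem_Ico]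
  constructor
  · rintro ⟨b, h1, h2⟩
    cases b with
    | v n =>
      have := ha.pos n
      have := ha.leftEnd_add_le n
      have := ha.leftEnd_nonneg n
      simp only [left, length] at h1 h2
      constructor <;> linarith
    | w n =>
      have := ha.pos n
      have := ha.leftEnd_add_le n
      have := ha.leftEnd_nonneg n
      simp only [left, length] at h1 h2
      constructor <;> linarith
    | affine j =>
      simp only [left, length, Nat.cast_ofNat] at h1 h2
      have e : ((j : ℕ) : ℝ) ≤ 3 := by exact_mod_cast Nat.le_of_lt_succ j.2
      have e0 : (0 : ℝ) ≤ (j : ℕ) := Nat.cast_nonneg _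
      have hd : 0 < (1 - leftEndJ a) / 4 := by linarith
      constructor <;> nlinarith
  · rintro ⟨h1, h2⟩
    rcases lt_or_ge y (leftEndJ a) with h | h
    -- The least such `n` is positive because `leftEnd a 1 = 0`; writing it as `m + 1`, minimality
    -- puts `y` in the interval `I_(m+1)`.
    · have hex : ∃ n, y < leftEnd a (n + 1) :=
        (ha.tendsto_leftEnd.eventually_const_lt h).exists
      classical
      have hspec := Nat.find_spec hex
      have hne : Nat.find hex ≠ 0 := by
        intro h0
        rw [h0, zero_add, leftEnd_one] at hspec
        linarith
      obtain ⟨m, hm⟩ := Nat.exists_eq_succ_of_ne_zero hne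
      have hmin : ¬ y < leftEnd a (m + 1) := Nat.find_min hex (by omega)
      rw [hm, Nat.succ_eq_add_one, leftEnd_succ (m + 1) (by omega)] at hspec
      push Not at hmin
      rcases lt_or_ge y (leftEnd a (m + 1) + 2 * a (m + 1)) with h' | h'
      · exact ⟨.v m.succPNat, hmin, h'⟩
      · refine ⟨.w m.succPNat, h', ?_⟩
        simp only [left, length, Nat.succPNat_coe, Nat.succ_eq_add_one]
        linarith
    · have hd : 0 < (1 - leftEndJ a) / 4 := by linarith
      set d := (1 - leftEndJ a) / 4 with hdd
      have hq : 0 ≤ (y - leftEndJ a) / d := div_nonneg (by linarith) hd.le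
      have f1 := Nat.floor_le hq
      have f2 := Nat.lt_floor_add_one ((y - leftEndJ a) / d)
      rw [le_div_iff₀ hd] at f1
      rw [div_lt_iff₀ hd] at f2
      have f3 : ⌊(y - leftEndJ a) / d⌋₊ < 4 := by
        rw [Nat.floor_lt hq, div_lt_iff₀ hd, hdd]
        push_cast
        linarith
      refine ⟨.affine ⟨_, f3⟩, ?_⟩
      simp only [left, length, Nat.cast_ofNat, ← hdd]
      constructor <;> linarith

end Partition

/-! ### Derivatives, bijectivity and inverses of the branches. -/

section Branches

variable {a : ℕ → ℝ} (ha : IsWeight a)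

lemma continuous_branchDeriv (a : ℕ → ℝ) (N : ℕ) (b : Branch N) :
    Continuous (branchDeriv a N b) := by
  cases b with
  | v n =>
    change Continuous fun x : ℝ => a n * (1 + 2 * Real.cos (2 * Real.pi * (n : ℝ) ^ 4 * x) ^ 2)
    fun_prop
  | w n =>
    change Continuous fun x : ℝ => a n * (1 + 2 * Real.sin (2 * Real.pi * (n : ℝ) ^ 4 * x) ^ 2)
    fun_prop
  | affine j => exact continuous_const

lemma hasDerivAt_branch (a : ℕ → ℝ) (N : ℕ) (b : Branch N) (x : ℝ) :
    HasDerivAt (branch a N b) (branchDeriv a N b x) x := by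
  have h := intervalIntegral.integral_hasDerivAt_right
    ((continuous_branchDeriv a N b).intervalIntegrable 0 x)
    (continuous_branchDeriv a N b).stronglyMeasurable.stronglyMeasurableAtFilter
    (continuous_branchDeriv a N b).continuousAt
  exact h.const_add _

lemma continuous_branch (a : ℕ → ℝ) (N : ℕ) (b : Branch N) : Continuous (branch a N b) :=
  continuous_iff_continuousAt.2 fun x => (hasDerivAt_branch a N b x).continuousAt

lemma branch_zero (a : ℕ → ℝ) (N : ℕ) (b : Branch N) : branch a N b 0 = left a N b := by
  simp [branch]

lemma branchDeriv_v (a : ℕ → ℝ) (N : ℕ) (n : ℕ+) (x : ℝ) :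
    branchDeriv a N (.v n) x = a n * (2 + Real.cos (4 * Real.pi * (n : ℝ) ^ 4 * x)) := by
  rw [branchDeriv, show 4 * Real.pi * (n : ℝ) ^ 4 * x = 2 * (2 * Real.pi * (n : ℝ) ^ 4 * x) by ring,
    Real.cos_two_mul]
  ring

lemma branchDeriv_w (a : ℕ → ℝ) (N : ℕ) (n : ℕ+) (x : ℝ) :
    branchDeriv a N (.w n) x = a n * (2 - Real.cos (4 * Real.pi * (n : ℝ) ^ 4 * x)) := by
  rw [branchDeriv, show 4 * Real.pi * (n : ℝ) ^ 4 * x = 2 * (2 * Real.pi * (n : ℝ) ^ 4 * x) by ring,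
    Real.cos_two_mul']
  linear_combination a n * (Real.sin_sq_add_cos_sq (2 * Real.pi * (n : ℝ) ^ 4 * x))

lemma integral_branchDeriv_v (a : ℕ → ℝ) (N : ℕ) (n : ℕ+) (x : ℝ) :
    ∫ t in (0 : ℝ)..x, branchDeriv a N (.v n) t = a n * (2 * x +
      Real.sin (4 * Real.pi * (n : ℝ) ^ 4 * x) / (4 * Real.pi * (n : ℝ) ^ 4)) := by
  have hn := one_le_pnat n
  have hc : 4 * Real.pi * (n : ℝ) ^ 4 ≠ 0 := by positivity
  rw [intervalIntegral.integral_eq_sub_of_hasDerivAt (f := fun x => a n * (2 * x +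
      Real.sin (4 * Real.pi * (n : ℝ) ^ 4 * x) / (4 * Real.pi * (n : ℝ) ^ 4)))]
  · simp
  · intro t _
    rw [branchDeriv_v]
    have h1 := (((hasDerivAt_id t).const_mul (4 * Real.pi * (n : ℝ) ^ 4)).sin).div_const
      (4 * Real.pi * (n : ℝ) ^ 4)
    have h2 := (((hasDerivAt_id t).const_mul 2).add h1).const_mul (a n)
    convert! h2 using 2
    simp only [id, mul_one]
    field_simp
  · exact (continuous_branchDeriv a N _).intervalIntegrable _ _

lemma integral_branchDeriv_w (a : ℕ → ℝ) (N : ℕ) (n : ℕ+) (x : ℝ) :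
    ∫ t in (0 : ℝ)..x, branchDeriv a N (.w n) t = a n * (2 * x -
      Real.sin (4 * Real.pi * (n : ℝ) ^ 4 * x) / (4 * Real.pi * (n : ℝ) ^ 4)) := by
  have h : ∀ t, branchDeriv a N (.w n) t = 4 * a n - branchDeriv a N (.v n) t := by
    intro t; rw [branchDeriv_v, branchDeriv_w]; ring
  simp_rw [h]
  rw [intervalIntegral.integral_sub (by simp)
    ((continuous_branchDeriv a N _).intervalIntegrable _ _), integral_branchDeriv_v]
  simp
  ring

/-- The unit interval contains a whole number of periods of the cosine, so its integral vanishes and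
only the mean slope `2 a_n` remains. -/
lemma branch_one (a : ℕ → ℝ) (N : ℕ) (b : Branch N) :
    branch a N b 1 = left a N b + length a N b := by
  have hs : ∀ n : ℕ+, Real.sin (4 * Real.pi * (n : ℝ) ^ 4 * 1) = 0 := by
    intro n
    rw [show 4 * Real.pi * (n : ℝ) ^ 4 * 1 = ((4 * (n : ℕ) ^ 4 : ℕ) : ℝ) * Real.pi by
      push_cast; ring]
    exact Real.sin_nat_mul_pi _
  cases b with
  | v n =>
    rw [branch, integral_branchDeriv_v, hs, length]
    ring
  | w n =>
    rw [branch, integral_branchDeriv_w, hs, length]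
    ring
  | affine j => simp [branch, branchDeriv, length]

-- Valid on the whole line, so that each branch extends to a bijection of `ℝ` and its inverse is
-- differentiable at the end points of the piece too.
include ha in
lemma IsWeight.half_length_le_branchDeriv (b : Branch 4) (x : ℝ) :
    length a 4 b / 2 ≤ branchDeriv a 4 b x := by
  have hl := ha.length_pos b
  cases b with
  | v n =>
    rw [branchDeriv_v, length]
    nlinarith [ha.pos n, Real.neg_one_le_cos (4 * Real.pi * (n : ℝ) ^ 4 * x)]
  | w n =>
    rw [branchDeriv_w, length]
    nlinarith [ha.pos n, Real.cos_le_one (4 * Real.pi * (n : ℝ) ^ 4 * x)]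
  | affine j =>
    simp only [length, branchDeriv] at hl ⊢
    linarith

include ha in
lemma IsWeight.branchDeriv_pos (b : Branch 4) (x : ℝ) : 0 < branchDeriv a 4 b x :=
  (half_pos (ha.length_pos b)).trans_le (ha.half_length_le_branchDeriv b x)

include ha in
lemma IsWeight.branchDeriv_v_le (n : ℕ+) (x : ℝ) : branchDeriv a 4 (.v n) x ≤ 3 * a n := by
  rw [branchDeriv_v]
  nlinarith [ha.pos n, Real.cos_le_one (4 * Real.pi * (n : ℝ) ^ 4 * x)]

include ha in
lemma IsWeight.branchDeriv_w_le (n : ℕ+) (x : ℝ) : branchDeriv a 4 (.w n) x ≤ 3 * a n := by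
  rw [branchDeriv_w]
  nlinarith [ha.pos n, Real.neg_one_le_cos (4 * Real.pi * (n : ℝ) ^ 4 * x)]

include ha in
lemma IsWeight.branchDeriv_le_quarter (b : Branch 4) (x : ℝ) : branchDeriv a 4 b x ≤ 1 / 4 := by
  cases b with
  | v n => linarith [ha.branchDeriv_v_le n x, ha.le n]
  | w n => linarith [ha.branchDeriv_w_le n x, ha.le n]
  | affine j =>
    simp only [branchDeriv, Nat.cast_ofNat]
    linarith [ha.leftEndJ_pos]

include ha in
lemma IsWeight.strictMono_branch (b : Branch 4) : StrictMono (branch a 4 b) :=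
  strictMono_of_hasDerivAt_pos (fun x => hasDerivAt_branch a 4 b x)
    fun x => ha.branchDeriv_pos b x

include ha in
lemma IsWeight.bijOn_branch (b : Branch 4) :
    Set.BijOn (branch a 4 b) (Set.Ico (0 : ℝ) 1) (piece a 4 b) := by
  have hm := ha.strictMono_branch b
  refine ⟨?_, hm.injective.injOn, ?_⟩
  · intro x hx
    rw [piece, ← branch_one, ← branch_zero]
    exact ⟨hm.monotone hx.1, hm hx.2⟩
  · rw [piece, ← branch_one, ← branch_zero]
    exact intermediate_value_Ico zero_le_one (continuous_branch a 4 b).continuousOn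

/-- A function whose derivative is bounded below by a positive constant is onto. -/
lemma surjective_of_hasDerivAt_ge {f f' : ℝ → ℝ} {c : ℝ} (hc : 0 < c)
    (hf : ∀ x, HasDerivAt f (f' x) x) (hf' : ∀ x, c ≤ f' x) : Function.Surjective f := by
  have hcont : Continuous f := continuous_iff_continuousAt.2 fun x => (hf x).continuousAt
  have hmono : Monotone fun x => f x - c * x :=
    monotone_of_hasDerivAt_nonneg (fun x => (hf x).sub ((hasDerivAt_id x).const_mul c))
      fun x => by simpa using hf' x
  have hbot : Filter.Tendsto (fun x : ℝ => f 0 + c * x) Filter.atBot Filter.atBot :=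
    Filter.tendsto_atBot_add_const_left _ _ (Filter.tendsto_id.const_mul_atBot hc)
  have htop : Filter.Tendsto (fun x : ℝ => f 0 + c * x) Filter.atTop Filter.atTop :=
    Filter.tendsto_atTop_add_const_left _ _ (Filter.tendsto_id.const_mul_atTop hc)
  refine hcont.surjective ?_ ?_
  · refine Filter.tendsto_atTop_mono' _ ?_ htop
    filter_upwards [Filter.eventually_ge_atTop 0] with x hx
    have := hmono hx
    simp only [mul_zero, sub_zero] at this
    linarith
  · refine Filter.tendsto_atBot_mono' _ ?_ hbot
    filter_upwards [Filter.eventually_le_atBot 0] with x hx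
    have := hmono hx
    simp only [mul_zero, sub_zero] at this
    linarith

include ha in
/-- The inverse of a branch, as a function on the real line, is differentiable. -/
lemma IsWeight.exists_inverse_branch (b : Branch 4) :
    ∃ g : ℝ → ℝ, (∀ x, g (branch a 4 b x) = x) ∧ (∀ y, branch a 4 b (g y) = y) ∧
      ∀ x, HasDerivAt g (branchDeriv a 4 b x)⁻¹ (branch a 4 b x) := by
  have hs : Function.Surjective (branch a 4 b) :=
    surjective_of_hasDerivAt_ge (half_pos (ha.length_pos b)) (hasDerivAt_branch a 4 b)
      (ha.half_length_le_branchDeriv b)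
  let e := StrictMono.orderIsoOfSurjective _ (ha.strictMono_branch b) hs
  have h1 : ∀ x, e.symm (branch a 4 b x) = x := fun x => e.symm_apply_apply x
  have h2 : ∀ y, branch a 4 b (e.symm y) = y := fun y => e.apply_symm_apply y
  refine ⟨e.symm, h1, h2, fun x => ?_⟩
  refine HasDerivAt.of_local_left_inverse e.symm.continuous.continuousAt ?_
    (ha.branchDeriv_pos b x).ne' (Filter.Eventually.of_forall h2)
  rw [h1]
  exact hasDerivAt_branch a 4 b x

end Branches

/-! ### The map `T`, its right derivative, and the transfer operator as a sum over branches. -/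

section Inverse

variable {a : ℕ → ℝ} (ha : IsWeight a)

/-- The inverse branch as a map of the interval `[0,1)` to itself. -/
noncomputable def IsWeight.branchMap (b : Branch 4) (x : I) : I :=
  ⟨branch a 4 b x,
    ha.iUnion_piece.subset (Set.mem_iUnion_of_mem b ((ha.bijOn_branch b).mapsTo x.2))⟩

lemma IsWeight.coe_branchMap (b : Branch 4) (x : I) : (ha.branchMap b x : ℝ) = branch a 4 b x := rfl

include ha in
lemma IsWeight.injective_branch :
    Function.Injective fun p : Branch 4 × I => branch a 4 p.1 p.2 := by
  rintro ⟨b, x⟩ ⟨b', x'⟩ h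
  simp only at h
  have h1 := (ha.bijOn_branch b).mapsTo x.2
  have h2 := (ha.bijOn_branch b').mapsTo x'.2
  rw [← h] at h2
  obtain rfl : b = b' := by
    by_contra hb
    exact Set.disjoint_left.1 (ha.disjoint_piece hb) h1 h2
  rw [Subtype.ext ((ha.strictMono_branch b).injective h)]

include ha in
lemma IsWeight.intervalMap_eq {b : Branch 4} {x y : I} (h : (y : ℝ) = branch a 4 b x) :
    intervalMap a 4 y = x := by
  rw [intervalMap, h]
  exact congrArg Prod.snd (Function.leftInverse_invFun ha.injective_branch (b, x))

lemma IsWeight.intervalMap_branchMap (b : Branch 4) (x : I) :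
    intervalMap a 4 (ha.branchMap b x) = x := ha.intervalMap_eq rfl

lemma IsWeight.exists_branchMap_eq (y : I) : ∃ b x, ha.branchMap b x = y := by
  have hy : (y : ℝ) ∈ ⋃ b : Branch 4, piece a 4 b := ha.iUnion_piece.symm.subset y.2
  obtain ⟨b, hb⟩ := Set.mem_iUnion.1 hy
  obtain ⟨x, hx, hxy⟩ := (ha.bijOn_branch b).surjOn hb
  exact ⟨b, ⟨x, hx⟩, Subtype.ext hxy⟩

/-- The pieces are closed on the left, so from any of its points `T` agrees with the inverse of a
single branch on a right neighbourhood. -/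
lemma IsWeight.rightDeriv_branchMap (b : Branch 4) (x : I) :
    rightDeriv (intervalMap a 4) (ha.branchMap b x) = (branchDeriv a 4 b x)⁻¹ := by
  obtain ⟨g, hg, -, hd⟩ := ha.exists_inverse_branch b
  have hx := (ha.bijOn_branch b).mapsTo x.2
  have hval : ∀ u ∈ piece a 4 b,
      Function.extend Subtype.val (fun z : I => (intervalMap a 4 z : ℝ)) 0 u = g u := by
    intro u hu
    obtain ⟨t, ht, rfl⟩ := (ha.bijOn_branch b).surjOn hu
    rw [hg]
    change Function.extend Subtype.val (fun z : I => (intervalMap a 4 z : ℝ)) 0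
      ((ha.branchMap b ⟨t, ht⟩ : I) : ℝ) = t
    rw [Subtype.val_injective.extend_apply, ha.intervalMap_branchMap]
  rw [rightDeriv, ha.coe_branchMap]
  refine HasDerivWithinAt.derivWithin ?_ (uniqueDiffOn_Ico _ _ _ ⟨le_rfl, ?_⟩)
  · refine (hd x).hasDerivWithinAt.congr_of_eventuallyEq ?_ (hval _ hx)
    filter_upwards [self_mem_nhdsWithin,
      mem_nhdsWithin_of_mem_nhds (Iio_mem_nhds hx.2)] with u hu hu'
    exact hval u ⟨hx.1.trans hu.1, hu'⟩
  · exact (ha.branchMap b x).2.2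

lemma IsWeight.transfer_eq (f : I → ℂ) (x : I) :
    transfer (intervalMap a 4) f x =
      ∑' b : Branch 4, (branchDeriv a 4 b x : ℂ) * f (ha.branchMap b x) := by
  let e : Branch 4 → {y : I // intervalMap a 4 y = x} :=
    fun b => ⟨ha.branchMap b x, ha.intervalMap_branchMap b x⟩
  have he : Function.Bijective e := by
    constructor
    · intro b b' h
      have h' : branch a 4 b x = branch a 4 b' x := congrArg (fun z => ((z.1 : I) : ℝ)) h
      exact congrArg Prod.fst (ha.injective_branch (a₁ := (b, x)) (a₂ := (b', x)) h')
    · rintro ⟨y, hy⟩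
      obtain ⟨b, t, rfl⟩ := ha.exists_branchMap_eq y
      rw [ha.intervalMap_branchMap] at hy
      exact ⟨b, Subtype.ext (congrArg (ha.branchMap b) hy.symm)⟩
  rw [transfer, ← (Equiv.ofBijective e he).tsum_eq]
  refine tsum_congr fun b => ?_
  simp only [Equiv.ofBijective_apply, e, ha.rightDeriv_branchMap]
  push_cast
  rw [div_inv_eq_mul, mul_comm]

end Inverse

/-! ### Sums over branches, with `v_n` and `w_n` grouped in pairs. -/

section Sums

/-- The branches as a sum type. -/
def branchEquiv (N : ℕ) : (ℕ+ ⊕ ℕ+) ⊕ Fin N ≃ Branch N where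
  toFun
    | .inl (.inl n) => .v n
    | .inl (.inr n) => .w n
    | .inr j => .affine j
  invFun
    | .v n => .inl (.inl n)
    | .w n => .inl (.inr n)
    | .affine j => .inr j
  left_inv := by rintro ((n | n) | j) <;> rfl
  right_inv := by rintro (n | n | j) <;> rfl

instance (N : ℕ) : Countable (Branch N) := (branchEquiv N).symm.injective.countable

variable {E : Type*} [NormedAddCommGroup E]

lemma hasSum_branch {N : ℕ} {f : Branch N → E} {s t : E} (hv : HasSum (fun n => f (.v n)) s)
    (hw : HasSum (fun n => f (.w n)) t) : HasSum f (s + t + ∑ j, f (.affine j)) := by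
  rw [← (branchEquiv N).hasSum_iff]
  exact HasSum.sum (HasSum.sum hv hw) (hasSum_fintype _)

lemma tsum_branch [CompleteSpace E] {N : ℕ} {f : Branch N → E} (hf : Summable f) :
    ∑' b, f b = ∑' n, (f (.v n) + f (.w n)) + ∑ j, f (.affine j) := by
  have hv : Summable fun n => f (.v n) :=
    hf.comp_injective (i := Branch.v) fun m n h => by injection h
  have hw : Summable fun n => f (.w n) :=
    hf.comp_injective (i := Branch.w) fun m n h => by injection h
  rw [hv.tsum_add hw]
  exact (hasSum_branch hv.hasSum hw.hasSum).tsum_eq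

end Sums

/-! ### The derivatives of the inverse branches sum to `1`. -/

section Density

variable {a : ℕ → ℝ} (ha : IsWeight a)

include ha in
lemma IsWeight.hasSum_branchDeriv (x : ℝ) : HasSum (fun b : Branch 4 => branchDeriv a 4 b x) 1 := by
  have hv : Summable fun n : ℕ+ => branchDeriv a 4 (.v n) x :=
    Summable.of_nonneg_of_le (fun n => (ha.branchDeriv_pos _ x).le)
      (fun n => ha.branchDeriv_v_le n x) (ha.summable.mul_left 3)
  have hw : Summable fun n : ℕ+ => branchDeriv a 4 (.w n) x :=
    Summable.of_nonneg_of_le (fun n => (ha.branchDeriv_pos _ x).le)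
      (fun n => ha.branchDeriv_w_le n x) (ha.summable.mul_left 3)
  have key : ∑' n : ℕ+, branchDeriv a 4 (.v n) x + ∑' n : ℕ+, branchDeriv a 4 (.w n) x =
      leftEndJ a := by
    rw [← hv.tsum_add hw, leftEndJ, ← tsum_mul_left]
    refine tsum_congr fun n => ?_
    rw [branchDeriv_v, branchDeriv_w]
    ring
  have h := hasSum_branch (f := fun b : Branch 4 => branchDeriv a 4 b x) hv.hasSum hw.hasSum
  have hs : ∑ j : Fin 4, branchDeriv a 4 (.affine j) x = 1 - leftEndJ a := by
    simp only [branchDeriv, Finset.sum_const, Finset.card_univ, Fintype.card_fin, nsmul_eq_mul,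
      Nat.cast_ofNat]
    ring
  rw [key, hs, add_sub_cancel] at h
  exact h

end Density

/-! ### Integrability of absolutely convergent series. -/

section Tsum

variable {α ι E : Type*} [MeasurableSpace α] {μ : Measure α} [Countable ι]
  [NormedAddCommGroup E] [CompleteSpace E]

/-- A series of integrable functions that converges absolutely in `L¹` has an integrable sum. -/
lemma integrable_tsum_of_summable_integral_norm {F : ι → α → E} (hF : ∀ i, Integrable (F i) μ)
    (hs : Summable fun i => ∫ a, ‖F i a‖ ∂μ) : Integrable (fun a => ∑' i, F i a) μ := by
  have hfin : ∫⁻ a, ∑' i, ‖F i a‖ₑ ∂μ ≠ ∞ := by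
    rw [lintegral_tsum fun i => (hF i).1.enorm]
    have : ∀ i, ∫⁻ a, ‖F i a‖ₑ ∂μ = ENNReal.ofReal (∫ a, ‖F i a‖ ∂μ) := fun i =>
      (ofReal_integral_norm_eq_lintegral_enorm (hF i)).symm
    simp_rw [this]
    exact hs.tsum_ofReal_ne_top
  have hae : ∀ᵐ a ∂μ, Summable fun i => F i a := by
    filter_upwards [ae_lt_top' (AEMeasurable.tsum fun i => (hF i).1.enorm) hfin] with a ha
    have h := ENNReal.tsum_coe_ne_top_iff_summable.1 ha.ne
    exact Summable.of_norm (NNReal.summable_coe.2 h)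
  constructor
  · refine aestronglyMeasurable_of_tendsto_ae (Filter.atTop : Filter (Finset ι))
      (f := fun s a => ∑ i ∈ s, F i a) (fun s => ?_) ?_
    · exact Finset.aestronglyMeasurable_fun_sum s fun i _ => (hF i).1
    · filter_upwards [hae] with a ha using ha.hasSum
  · refine lt_of_le_of_lt (lintegral_mono fun a => ?_) hfin.lt_top
    exact enorm_tsum_le_tsum_enorm

end Tsum

/-! ### Invariance of Lebesgue measure and duality of the transfer operator. -/

section Measure

variable {a : ℕ → ℝ} (ha : IsWeight a)

instance : StandardBorelSpace I := measurableSet_Ico.standardBorel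

lemma IsWeight.continuous_branchMap (b : Branch 4) : Continuous (ha.branchMap b) :=
  ((continuous_branch a 4 b).comp continuous_subtype_val).subtype_mk _

lemma IsWeight.injective_branchMap (b : Branch 4) : Function.Injective (ha.branchMap b) := by
  intro x y h
  exact Subtype.ext ((ha.strictMono_branch b).injective (congrArg Subtype.val h))

lemma IsWeight.measurableEmbedding_branchMap (b : Branch 4) :
    MeasurableEmbedding (ha.branchMap b) :=
  (ha.continuous_branchMap b).measurable.measurableEmbedding (ha.injective_branchMap b)

lemma IsWeight.disjoint_range_branchMap :
    Pairwise fun b b' : Branch 4 =>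
      Disjoint (Set.range (ha.branchMap b)) (Set.range (ha.branchMap b')) := by
  intro b b' hb
  rw [Set.disjoint_left]
  rintro _ ⟨x, rfl⟩ ⟨y, hy⟩
  exact hb (congrArg Prod.fst (ha.injective_branch (a₁ := (b, x)) (a₂ := (b', y))
    (congrArg Subtype.val hy.symm)))

/-- The density of the image of Lebesgue measure under a branch. -/
noncomputable def branchDensity (a : ℕ → ℝ) (b : Branch 4) (x : I) : ℝ≥0 :=
  (branchDeriv a 4 b x).toNNReal

lemma measurable_branchDensity (a : ℕ → ℝ) (b : Branch 4) : Measurable (branchDensity a b) :=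
  ((continuous_branchDeriv a 4 b).comp continuous_subtype_val).measurable.real_toNNReal

include ha in
lemma IsWeight.coe_branchDensity (b : Branch 4) (x : I) :
    (branchDensity a b x : ℝ) = branchDeriv a 4 b x :=
  Real.coe_toNNReal _ (ha.branchDeriv_pos b x).le

lemma IsWeight.setLIntegral_branchDensity (b : Branch 4) {A : Set I} (hA : MeasurableSet A) :
    ∫⁻ x in A, branchDensity a b x = volume (ha.branchMap b '' A) := by
  have h1 : volume (ha.branchMap b '' A) =
      volume (branch a 4 b '' ((↑) '' A : Set ℝ)) := by
    rw [← volume_image_subtype_coe measurableSet_Ico, Set.image_image, Set.image_image]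
    rfl
  have hA' : MeasurableSet ((↑) '' A : Set ℝ) := measurableSet_Ico.subtype_image hA
  rw [h1, ← lintegral_deriv_eq_volume_image_of_monotoneOn hA'
    (fun x _ => (hasDerivAt_branch a 4 b x).hasDerivWithinAt)
    ((ha.strictMono_branch b).monotone.monotoneOn _)]
  exact setLIntegral_subtype measurableSet_Ico A
    fun x => ENNReal.ofReal (branchDeriv a 4 b x)

/-- Lebesgue measure is the sum of its images under the branches. -/
lemma IsWeight.volume_eq_sum : (volume : Measure I) = Measure.sum fun b : Branch 4 =>
    (volume.withDensity fun x => (branchDensity a b x : ℝ≥0∞)).map (ha.branchMap b) := by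
  ext A hA
  rw [Measure.sum_apply _ hA]
  have h : ∀ b, (volume.withDensity fun x => (branchDensity a b x : ℝ≥0∞)).map
      (ha.branchMap b) A = volume (A ∩ Set.range (ha.branchMap b)) := by
    intro b
    have hm := (ha.measurableEmbedding_branchMap b).measurable
    rw [Measure.map_apply hm hA, withDensity_apply _ (hm hA),
      ha.setLIntegral_branchDensity b (hm hA), Set.image_preimage_eq_inter_range]
  simp_rw [h]
  rw [← measure_iUnion, ← Set.inter_iUnion]
  · congr 1
    symm
    rw [Set.inter_eq_left]
    intro y _
    obtain ⟨b, x, rfl⟩ := ha.exists_branchMap_eq y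
    exact Set.mem_iUnion_of_mem b ⟨x, rfl⟩
  · exact fun b b' hb =>
      (ha.disjoint_range_branchMap hb).mono Set.inter_subset_right Set.inter_subset_right
  · exact fun b => hA.inter (ha.measurableEmbedding_branchMap b).measurableSet_range

include ha in
lemma IsWeight.tsum_branchDensity (x : I) : ∑' b : Branch 4, (branchDensity a b x : ℝ≥0∞) = 1 := by
  have h := ha.hasSum_branchDeriv x
  simp_rw [← ha.coe_branchDensity] at h
  have h' : HasSum (fun b : Branch 4 => branchDensity a b x) 1 := NNReal.hasSum_coe.1 h
  exact (ENNReal.hasSum_coe.2 h').tsum_eq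

include ha in
lemma IsWeight.measurable_intervalMap : Measurable (intervalMap a 4) := by
  intro A hA
  have : intervalMap a 4 ⁻¹' A = ⋃ b : Branch 4, ha.branchMap b '' A := by
    ext y
    simp only [Set.mem_preimage, Set.mem_iUnion, Set.mem_image]
    constructor
    · intro hy
      obtain ⟨b, x, rfl⟩ := ha.exists_branchMap_eq y
      rw [ha.intervalMap_branchMap] at hy
      exact ⟨b, x, hy, rfl⟩
    · rintro ⟨b, x, hx, rfl⟩
      rwa [ha.intervalMap_branchMap]
  rw [this]
  exact MeasurableSet.iUnion fun b =>
    (ha.measurableEmbedding_branchMap b).measurableSet_image.2 hA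

-- Each branch is a section of `T`, so the part of the preimage of `A` lying in one piece has
-- measure equal to the integral of the branch derivative over `A`; these derivatives sum to `1`.
include ha in
lemma IsWeight.measurePreserving : MeasurePreserving (intervalMap a 4) volume volume := by
  refine ⟨ha.measurable_intervalMap, ?_⟩
  ext A hA
  have hT := ha.measurable_intervalMap hA
  rw [Measure.map_apply ha.measurable_intervalMap hA]
  conv_lhs => rw [ha.volume_eq_sum]
  rw [Measure.sum_apply _ hT]
  have h : ∀ b, (volume.withDensity fun x => (branchDensity a b x : ℝ≥0∞)).map
      (ha.branchMap b) (intervalMap a 4 ⁻¹' A) = ∫⁻ x in A, branchDensity a b x := by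
    intro b
    rw [Measure.map_apply (ha.measurableEmbedding_branchMap b).measurable hT, ← Set.preimage_comp,
      ← withDensity_apply _ hA]
    congr 2
    ext x
    simp [ha.intervalMap_branchMap]
  simp_rw [h]
  rw [← lintegral_tsum fun b => (measurable_branchDensity a b).coe_nnreal_ennreal.aemeasurable]
  simp_rw [ha.tsum_branchDensity]
  simp

include ha in
/-- The transfer operator maps integrable functions to integrable functions and preserves
the integral. -/
lemma IsWeight.integrable_transfer {f : I → ℂ} (hf : Integrable f) :
    Integrable (transfer (intervalMap a 4) f) ∧
      ∫ x, transfer (intervalMap a 4) f x = ∫ x, f x := by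
  have hf' := hf
  rw [ha.volume_eq_sum] at hf'
  have hF : transfer (intervalMap a 4) f =
      fun x => ∑' b : Branch 4, branchDensity a b x • f (ha.branchMap b x) := by
    funext x
    rw [ha.transfer_eq]
    refine tsum_congr fun b => ?_
    rw [NNReal.smul_def, Complex.real_smul, ha.coe_branchDensity]
  have h1 : ∀ b, Integrable fun x => branchDensity a b x • f (ha.branchMap b x) := fun b => by
    have h := hf'.mono_measure (Measure.le_sum _ b)
    rw [(ha.measurableEmbedding_branchMap b).integrable_map_iff,
      integrable_withDensity_iff_integrable_smul (measurable_branchDensity a b)] at h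
    exact h
  have h2 : Summable fun b => ∫ x, ‖branchDensity a b x • f (ha.branchMap b x)‖ := by
    have h := hf'.norm.summable_integral
    refine h.congr fun b => ?_
    rw [(ha.measurableEmbedding_branchMap b).integral_map,
      integral_withDensity_eq_integral_smul (measurable_branchDensity a b)]
    simp [NNReal.smul_def]
  rw [hF]
  refine ⟨integrable_tsum_of_summable_integral_norm h1 h2, ?_⟩
  rw [← integral_tsum_of_summable_integral_norm h1 h2]
  conv_rhs => rw [ha.volume_eq_sum]
  rw [integral_sum_measure hf']
  refine tsum_congr fun b => ?_
  rw [(ha.measurableEmbedding_branchMap b).integral_map,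
      integral_withDensity_eq_integral_smul (measurable_branchDensity a b)]

-- Since `g ∘ T` is constant along the fibres of `T`, it factors out: `L (f · g ∘ T) = (L f) · g`.
-- Duality is then preservation of the integral.
include ha in
lemma IsWeight.integral_mul_comp {f g : I → ℂ} (hf : Integrable f) (hg : Measurable g)
    (hb : ∃ C : ℝ, ∀ x, ‖g x‖ ≤ C) :
    ∫ x, f x * g (intervalMap a 4 x) = ∫ x, transfer (intervalMap a 4) f x * g x := by
  obtain ⟨C, hC⟩ := hb
  have h : Integrable fun x => f x * g (intervalMap a 4 x) :=
    hf.mul_bdd (c := C) (hg.comp ha.measurable_intervalMap).aestronglyMeasurable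
      (Filter.Eventually.of_forall fun x => hC _)
  rw [← (ha.integrable_transfer h).2]
  congr 1
  funext x
  rw [ha.transfer_eq, ha.transfer_eq, ← tsum_mul_right]
  refine tsum_congr fun b => ?_
  rw [ha.intervalMap_branchMap, mul_assoc]

end Measure

/-! ### Spectral gap from a rank-one perturbation with decaying powers. -/

section Spectral

variable {E : Type*} [NormedAddCommGroup E] [NormedSpace ℂ E]

lemma eq_zero_of_isUnit {A : E →L[ℂ] E} (hA : IsUnit A) {x : E} (hx : A x = 0) : x = 0 := by
  obtain ⟨u, rfl⟩ := hA
  have h : ((↑u⁻¹ : E →L[ℂ] E) * (u : E →L[ℂ] E)) x = 0 := by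
    rw [mul_apply_eq_comp, hx, map_zero]
  simpa using h

lemma mem_spectrum_of_hasEigenvalue {A : E →L[ℂ] E} {z : ℂ}
    (hz : Module.End.HasEigenvalue (A : E →ₗ[ℂ] E) z) : z ∈ spectrum ℂ A := by
  obtain ⟨x, hx⟩ := hz.exists_hasEigenvector
  intro h
  refine hx.2 (eq_zero_of_isUnit h ?_)
  have h1 : A x = z • x := hx.apply_eq_smul
  simp [Algebra.algebraMap_eq_smul_one, h1]

variable [CompleteSpace E]

/-- If the powers of `Q` decay like `θ ^ n`, the spectrum of `Q` lies in the disc of radius `θ`. -/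
lemma norm_le_of_mem_spectrum_of_pow_le {Q : E →L[ℂ] E} {C θ : ℝ} (hθ : 0 < θ)
    (hQ : ∀ n, ‖Q ^ n‖ ≤ C * θ ^ n) {z : ℂ} (hz : z ∈ spectrum ℂ Q) : ‖z‖ ≤ θ := by
  by_contra! hlt
  have h1 : 1 < ‖z‖ / θ := (one_lt_div hθ).2 hlt
  obtain ⟨n, hn⟩ := pow_unbounded_of_one_lt (C * ‖(1 : E →L[ℂ] E)‖) h1
  have h2 := spectrum.norm_le_norm_mul_of_mem (spectrum.pow_mem_pow Q n hz)
  rw [norm_pow] at h2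
  rw [div_pow, lt_div_iff₀ (by positivity)] at hn
  have h3 : ‖Q ^ n‖ * ‖(1 : E →L[ℂ] E)‖ ≤ C * θ ^ n * ‖(1 : E →L[ℂ] E)‖ := by
    gcongr
    exact hQ n
  linarith

/-- Spectral gap for an operator with an invariant functional and a fixed vector, whose
restriction to the kernel of the functional is eventually contracting. -/
theorem spectralGap_of_pow_le {L : E →L[ℂ] E} {φ : E →L[ℂ] ℂ} {e : E} {C θ : ℝ}
    (hθ0 : 0 < θ) (hθ1 : θ < 1) (he : φ e = 1) (hLe : L e = e) (hφL : ∀ f, φ (L f) = φ f)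
    (hQ : ∀ n, ‖(L - φ.smulRight e) ^ n‖ ≤ C * θ ^ n) :
    essSpectralRadius L ≤ ENNReal.ofReal θ ∧
      Module.End.HasEigenvalue (L : E →ₗ[ℂ] E) 1 ∧
      Module.finrank ℂ (Module.End.maxGenEigenspace (L : E →ₗ[ℂ] E) 1) = 1 ∧
      (∀ z : ℂ, Module.End.HasEigenvalue (L : E →ₗ[ℂ] E) z → ‖z‖ = 1 → z = 1) ∧
      ∀ z ∈ spectrum ℂ L, z = 1 ∨ ‖z‖ ≤ θ := by
  set P : E →L[ℂ] E := φ.smulRight e with hP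
  set Q : E →L[ℂ] E := L - P with hQdef
  have hPa : ∀ f, P f = φ f • e := fun f => rfl
  have hQa : ∀ f, Q f = L f - φ f • e := fun f => rfl
  have he0 : e ≠ 0 := by rintro rfl; simp at he
  have hunit : ∀ z : ℂ, θ < ‖z‖ → IsUnit (z • (1 : E →L[ℂ] E) - Q) := by
    intro z hz
    rw [← Algebra.algebraMap_eq_smul_one]
    by_contra h
    exact absurd (norm_le_of_mem_spectrum_of_pow_le hθ0 hQ h) (not_le.2 hz)
  -- For a fixed `f`, the vector `f - φ f • e` is annihilated by `1 - Q`, which is invertible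
  -- because `θ < 1`.
  have hfix : ∀ f, L f = f → f = φ f • e := by
    intro f hf
    have h1 := hunit 1 (by simpa using hθ1)
    have h2 := eq_zero_of_isUnit (x := f - φ f • e) h1 (by simp [hQa, hf, hLe, he])
    exact sub_eq_zero.1 h2
  have hspec : ∀ z ∈ spectrum ℂ L, z = 1 ∨ ‖z‖ ≤ θ := by
    intro z hz
    by_contra! hcon
    obtain ⟨hz1, hzθ⟩ := hcon
    have hz0 : z ≠ 0 := by rintro rfl; simp at hzθ; linarith
    have hz1' : z - 1 ≠ 0 := sub_ne_zero.2 hz1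
    apply hz
    -- The factorization holds because `Q e = 0`, hence `Q P = 0`. As `P` is a projection, the
    -- second factor has the explicit inverse `1 + (z - 1)⁻¹ P` when `z` is not `0` or `1`.
    have hfac : algebraMap ℂ (E →L[ℂ] E) z - L =
        (z • (1 : E →L[ℂ] E) - Q) * (1 - z⁻¹ • P) := by
      ext f
      simp [Algebra.algebraMap_eq_smul_one, hPa, hQa, smul_sub, smul_smul, hz0, hLe, he]
      module
    rw [spectrum.mem_resolventSet_iff, hfac]
    refine (hunit z hzθ).mul ⟨⟨1 - z⁻¹ • P, 1 + (z - 1)⁻¹ • P, ?_, ?_⟩, rfl⟩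
    · ext f
      simp only [mul_apply_eq_comp, sub_apply,
        add_apply, one_apply_eq_self,
        smul_apply, hPa, map_add, map_smul, he]
      match_scalars <;> field_simp <;> ring
    · ext f
      simp only [mul_apply_eq_comp, sub_apply,
        add_apply, one_apply_eq_self,
        smul_apply, hPa, map_sub, map_smul, he]
      match_scalars <;> field_simp <;> ring
  refine ⟨?_, ?_, ?_, ?_, hspec⟩
  · refine iSup₂_le fun z hz => ?_
    rw [← ofReal_norm]
    refine ENNReal.ofReal_le_ofReal ?_
    by_contra! hzθ
    obtain ⟨u, hu⟩ := hunit z hzθ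
    set S : E →L[ℂ] E := ((u⁻¹ : (E →L[ℂ] E)ˣ) : E →L[ℂ] E) with hS
    have hl : ∀ f, S (z • f - Q f) = f := fun f => by
      have h : (S * (u : E →L[ℂ] E)) f = f := by simp [hS]
      simpa [hu] using h
    have hr : ∀ f, z • S f - Q (S f) = f := fun f => by
      have h : ((u : E →L[ℂ] E) * S) f = f := by simp [hS]
      simpa [hu] using h
    have hcofg : ∀ ψ : E →L[ℂ] ℂ, (LinearMap.ker (ψ : E →ₗ[ℂ] ℂ)).CoFG := fun ψ => by
      rw [LinearMap.ker_coFG_iff_hasFiniteRange]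
      exact IsNoetherian.noetherian _
    -- The operators `z - L` and `z - Q` agree on the kernel of `φ`, of finite codimension, so the
    -- inverse `S` of `z - Q` inverts `z - L` modulo finite rank. This covers `z = 1` as well.
    refine hz (ContinuousLinearMap.IsFredholm.of_isQuasiInverse (v := S) ⟨?_, ?_⟩)
    · refine LinearMap.FiniteRangeSetoid.equiv_of_eqOn_coFG (hcofg φ) fun f hf => ?_
      have hf' : φ f = 0 := hf
      have h := hl f
      rw [hQa, hf', zero_smul, sub_zero] at h
      exact h
    · refine LinearMap.FiniteRangeSetoid.equiv_of_eqOn_coFG (hcofg (φ ∘L S)) fun f hf => ?_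
      have hf' : φ (S f) = 0 := hf
      have h := hr f
      rw [hQa, hf', zero_smul, sub_zero] at h
      exact h
  · refine Module.End.hasEigenvalue_of_hasEigenvector (x := e) ⟨?_, he0⟩
    rw [Module.End.mem_eigenspace_iff]
    simpa using hLe
  · have hspan : Module.End.maxGenEigenspace (L : E →ₗ[ℂ] E) 1 = Submodule.span ℂ {e} := by
      refine le_antisymm ?_ ?_
      · intro f hf
        rw [Module.End.mem_maxGenEigenspace] at hf
        obtain ⟨k, hk⟩ := hf
        rw [Submodule.mem_span_singleton]
        refine ⟨φ f, ?_⟩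
        induction k generalizing f with
        | zero =>
          have : f = 0 := by simpa using hk
          simp [this]
        | succ k ih =>
          rw [pow_succ, Module.End.mul_apply] at hk
          -- By induction `L f - f` is `φ (L f - f) • e`, which is zero by invariance of `φ`: there
          -- are no Jordan blocks, and `f` is itself fixed.
          have h := ih hk
          have h0 : ((L : E →ₗ[ℂ] E) - (1 : ℂ) • (1 : Module.End ℂ E)) f = L f - f := by simp
          rw [h0, map_sub, hφL, sub_self, zero_smul] at h
          exact (hfix f (sub_eq_zero.1 h.symm)).symm
      · rw [Submodule.span_le, Set.singleton_subset_iff, SetLike.mem_coe,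
          Module.End.mem_maxGenEigenspace]
        exact ⟨1, by simp [hLe]⟩
    rw [hspan, finrank_span_singleton he0]
  · intro z hz hz1
    rcases hspec z (mem_spectrum_of_hasEigenvalue hz) with h | h
    · exact h
    · linarith

end Spectral

/-! ### The Banach space of Lipschitz functions and its mean-value functional. -/

namespace Lip

lemma norm_apply_le_iSup (f : Lip) (x : I) : ‖f x‖ ≤ ⨆ x : I, ‖f x‖ := le_ciSup f.bddAbove_sup x

lemma lipConst_nonneg (f : I → ℂ) : 0 ≤ lipConst f :=
  Real.iSup_nonneg fun _ => div_nonneg (norm_nonneg _) dist_nonneg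

lemma iSup_norm_nonneg (f : Lip) : 0 ≤ ⨆ x : I, ‖f x‖ := Real.iSup_nonneg fun _ => norm_nonneg _

lemma norm_apply_le (f : Lip) (x : I) : ‖f x‖ ≤ ‖f‖ :=
  (f.norm_apply_le_iSup x).trans (le_add_of_nonneg_right (lipConst_nonneg f))

lemma lipConst_le_norm (f : Lip) : lipConst f ≤ ‖f‖ := le_add_of_nonneg_left f.iSup_norm_nonneg

lemma norm_sub_le (f : Lip) (x y : I) : ‖f x - f y‖ ≤ lipConst f * dist x y := by
  rcases eq_or_ne x y with rfl | h
  · simp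
  · rw [← div_le_iff₀ (dist_pos.2 h)]
    exact le_ciSup f.bddAbove_lip (x, y)

lemma lipConst_le {f : I → ℂ} {B : ℝ} (hB : 0 ≤ B) (h : ∀ x y, ‖f x - f y‖ ≤ B * dist x y) :
    lipConst f ≤ B :=
  ciSup_le fun p => div_le_of_le_mul₀ dist_nonneg hB (h p.1 p.2)

lemma norm_le {f : Lip} {A B : ℝ} (hB : 0 ≤ B) (hA : ∀ x, ‖f x‖ ≤ A)
    (h : ∀ x y, ‖f x - f y‖ ≤ B * dist x y) : ‖f‖ ≤ A + B :=
  add_le_add (ciSup_le hA) (lipConst_le hB h)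

/-- A function with a Lipschitz bound, as an element of `Lip`. -/
def ofBound (f : I → ℂ) (B : ℝ) (hB : 0 ≤ B) (h : ∀ x y, ‖f x - f y‖ ≤ B * dist x y) : Lip :=
  ⟨f, ⟨B, hB⟩, LipschitzWith.of_dist_le_mul fun x y => by rw [dist_eq_norm]; exact h x y⟩

lemma ofBound_apply (f : I → ℂ) (B : ℝ) (hB : 0 ≤ B) (h : ∀ x y, ‖f x - f y‖ ≤ B * dist x y)
    (x : I) : ofBound f B hB h x = f x := rfl

lemma sub_apply (f g : Lip) (x : I) : (f - g) x = f x - g x := rfl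

lemma ext {f g : Lip} (h : ∀ x, f x = g x) : f = g := Subtype.ext (funext h)

/-- A Cauchy sequence converges pointwise, and its sup and Lipschitz estimates survive letting one
of the two indices tend to infinity. -/
instance : CompleteSpace Lip := by
  refine Metric.complete_of_cauchySeq_tendsto fun u hu => ?_
  have hc : ∀ ε > 0, ∃ N, ∀ m ≥ N, ∀ n ≥ N, ‖u m - u n‖ < ε := by
    simpa only [dist_eq_norm] using Metric.cauchySeq_iff.1 hu
  have hpt : ∀ x, ∃ z, Filter.Tendsto (fun n => u n x) Filter.atTop (nhds z) := fun x => by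
    refine cauchySeq_tendsto_of_complete (Metric.cauchySeq_iff.2 fun ε hε => ?_)
    obtain ⟨N, hN⟩ := hc ε hε
    refine ⟨N, fun m hm n hn => ?_⟩
    rw [dist_eq_norm]
    exact (norm_apply_le (u m - u n) x).trans_lt (hN m hm n hn)
  choose g hg using hpt
  have hlim : ∀ ε > 0, ∃ N, ∀ n ≥ N, ∀ x y,
      ‖(u n x - g x) - (u n y - g y)‖ ≤ ε * dist x y ∧ ‖u n x - g x‖ ≤ ε := by
    intro ε hε
    obtain ⟨N, hN⟩ := hc ε hε
    refine ⟨N, fun n hn x y => ⟨?_, ?_⟩⟩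
    · have ht := ((tendsto_const_nhds (x := u n x)).sub (hg x)).sub
        ((tendsto_const_nhds (x := u n y)).sub (hg y))
      refine le_of_tendsto ht.norm ?_
      filter_upwards [Filter.eventually_ge_atTop N] with m hm
      refine ((u n - u m).norm_sub_le x y).trans ?_
      gcongr
      exact (lipConst_le_norm _).trans (hN n hn m hm).le
    · refine le_of_tendsto ((tendsto_const_nhds (x := u n x)).sub (hg x)).norm ?_
      filter_upwards [Filter.eventually_ge_atTop N] with m hm
      exact (norm_apply_le (u n - u m) x).trans (hN n hn m hm).le
  obtain ⟨N, hN⟩ := hlim 1 one_pos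
  let G : Lip := ofBound g (lipConst (u N) + 1) (add_nonneg (lipConst_nonneg _) zero_le_one)
    fun x y => by
      have h1 := (hN N le_rfl x y).1
      have h2 := (u N).norm_sub_le x y
      have h3 : g x - g y = (u N x - u N y) - ((u N x - g x) - (u N y - g y)) := by ring
      rw [h3, add_mul]
      exact (_root_.norm_sub_le _ _).trans (add_le_add h2 h1)
  refine ⟨G, Metric.tendsto_atTop.2 fun ε hε => ?_⟩
  obtain ⟨M, hM⟩ := hlim (ε / 3) (by positivity)
  refine ⟨M, fun n hn => ?_⟩
  rw [dist_eq_norm]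
  have h : ‖u n - G‖ ≤ ε / 3 + ε / 3 :=
    norm_le (by positivity) (fun x => (hM n hn x x).2) fun x y => (hM n hn x y).1
  linarith

lemma continuous (f : Lip) : Continuous (f : I → ℂ) := by
  obtain ⟨K, hK⟩ := f.2
  exact hK.continuous

instance : IsProbabilityMeasure (volume : Measure I) := by
  constructor
  rw [← volume_image_subtype_coe measurableSet_Ico, Set.image_univ, Subtype.range_coe]
  simp

lemma integrable (f : Lip) : Integrable (f : I → ℂ) :=
  Integrable.of_bound f.continuous.aestronglyMeasurable ‖f‖
    (Filter.Eventually.of_forall f.norm_apply_le)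

/-- The integral, as a functional on the space of Lipschitz functions. -/
noncomputable def mean : Lip →L[ℂ] ℂ :=
  LinearMap.mkContinuous
    { toFun := fun f => ∫ x, f x
      map_add' := fun f g => integral_add f.integrable g.integrable
      map_smul' := fun c f => integral_const_mul c _ } 1 fun f => by
    have h := norm_integral_le_of_norm_le_const (μ := (volume : Measure I))
      (Filter.Eventually.of_forall f.norm_apply_le)
    rw [one_mul]
    simpa only [probReal_univ, mul_one] using! h

lemma mean_apply (f : Lip) : mean f = ∫ x, f x := rfl

/-- The constant function `1`. -/
def one : Lip := ofBound (fun _ => 1) 0 le_rfl fun x y => by simp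

lemma one_apply (x : I) : one x = 1 := rfl

lemma mean_one : mean one = 1 := by simp [mean_apply, one_apply]

lemma dist_le_one (x y : I) : dist x y ≤ 1 := by
  rw [Subtype.dist_eq, Real.dist_eq, abs_le]
  constructor <;> linarith [x.2.1, x.2.2, y.2.1, y.2.2]

/-- A function of vanishing integral is bounded by its Lipschitz constant. -/
lemma norm_le_of_mean_eq_zero {f : Lip} (hf : mean f = 0) : ‖f‖ ≤ 2 * lipConst f := by
  have h : ∀ x, ‖f x‖ ≤ lipConst f := fun x => by
    have h1 : f x = ∫ y, (f x - f y) := by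
      rw [integral_sub (integrable_const _) f.integrable, ← mean_apply, hf]
      simp
    rw [h1]
    have h2 := norm_integral_le_of_norm_le_const (μ := (volume : Measure I))
      (f := fun y => f x - f y) (C := lipConst f) (Filter.Eventually.of_forall fun y =>
        (f.norm_sub_le x y).trans
          (mul_le_of_le_one_right (lipConst_nonneg f) (dist_le_one x y)))
    simpa using h2
  rw [two_mul]
  exact norm_le (lipConst_nonneg f) h f.norm_sub_le

end Lip

/-! ### Contraction of Lipschitz constants. -/

section Contraction

variable {a : ℕ → ℝ} (ha : IsWeight a)

lemma IsWeight.dist_branchMap_le {b : Branch 4} {C : ℝ} (hC : ∀ t, branchDeriv a 4 b t ≤ C)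
    (x y : I) : dist (ha.branchMap b x) (ha.branchMap b y) ≤ C * dist x y := by
  have h := convex_univ.norm_image_sub_le_of_norm_hasDerivWithin_le (f := branch a 4 b)
    (f' := branchDeriv a 4 b) (C := C) (x := (y : ℝ)) (y := (x : ℝ))
    (fun t _ => (hasDerivAt_branch a 4 b t).hasDerivWithinAt)
    (fun t _ => by rw [Real.norm_of_nonneg (ha.branchDeriv_pos b t).le]; exact hC t)
    (Set.mem_univ _) (Set.mem_univ _)
  simpa only [Subtype.dist_eq, dist_eq_norm, ha.coe_branchMap] using h

lemma IsWeight.dist_branchMap_v_w_le (n : ℕ+) (y : I) :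
    dist (ha.branchMap (.v n) y) (ha.branchMap (.w n) y) ≤ 4 * a n := by
  have h1 := (ha.bijOn_branch (.v n)).mapsTo y.2
  have h2 := (ha.bijOn_branch (.w n)).mapsTo y.2
  have := ha.pos n
  simp only [piece, left, length, Set.mem_Ico] at h1 h2
  rw [Subtype.dist_eq, Real.dist_eq, ha.coe_branchMap, ha.coe_branchMap, abs_le]
  constructor <;> linarith

lemma abs_branchDeriv_v_sub_le (ha : IsWeight a) (n : ℕ+) (x y : I) :
    |branchDeriv a 4 (.v n) x - branchDeriv a 4 (.v n) y| ≤
      a n * (4 * Real.pi * (n : ℝ) ^ 4 * dist x y) := by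
  rw [branchDeriv_v, branchDeriv_v, ← mul_sub, abs_mul, abs_of_pos (ha.pos n)]
  have h0 := (ha.pos n).le
  gcongr
  rw [add_sub_add_left_eq_sub]
  refine (Real.abs_cos_sub_cos_le _ _).trans_eq ?_
  rw [← mul_sub, abs_mul, abs_of_nonneg (by positivity), Subtype.dist_eq, Real.dist_eq]

/-- The oscillations of `v_n'` and `w_n'` cancel. -/
lemma IsWeight.norm_pair_sub_le {f : I → ℂ} {K : ℝ} (hK : 0 ≤ K)
    (hf : ∀ x y, ‖f x - f y‖ ≤ K * dist x y) (n : ℕ+) (x y : I) :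
    ‖((branchDeriv a 4 (.v n) x : ℂ) * f (ha.branchMap (.v n) x) -
        (branchDeriv a 4 (.v n) y : ℂ) * f (ha.branchMap (.v n) y)) +
      ((branchDeriv a 4 (.w n) x : ℂ) * f (ha.branchMap (.w n) x) -
        (branchDeriv a 4 (.w n) y : ℂ) * f (ha.branchMap (.w n) y))‖ ≤
      63 / 10000 * (1 / (n : ℝ) ^ 2) * (K * dist x y) := by
  have hn := one_le_pnat n
  have hsum : ∀ t, branchDeriv a 4 (.w n) t = 4 * a n - branchDeriv a 4 (.v n) t := by
    intro t; rw [branchDeriv_v, branchDeriv_w]; ring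
  have hw : (branchDeriv a 4 (.w n) x : ℂ) + branchDeriv a 4 (.v n) x =
      branchDeriv a 4 (.w n) y + branchDeriv a 4 (.v n) y := by
    rw [hsum, hsum]; push_cast; ring
  -- The increment of `w_n'` is minus that of `v_n'`, so the oscillating weight multiplies only a
  -- difference of values of `f` at two points of `I_n`.
  have hid : ((branchDeriv a 4 (.v n) x : ℂ) * f (ha.branchMap (.v n) x) -
        (branchDeriv a 4 (.v n) y : ℂ) * f (ha.branchMap (.v n) y)) +
      ((branchDeriv a 4 (.w n) x : ℂ) * f (ha.branchMap (.w n) x) -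
        (branchDeriv a 4 (.w n) y : ℂ) * f (ha.branchMap (.w n) y)) =
      (branchDeriv a 4 (.v n) x : ℂ) * (f (ha.branchMap (.v n) x) - f (ha.branchMap (.v n) y)) +
      (branchDeriv a 4 (.w n) x : ℂ) * (f (ha.branchMap (.w n) x) - f (ha.branchMap (.w n) y)) +
      ((branchDeriv a 4 (.v n) x - branchDeriv a 4 (.v n) y : ℝ) : ℂ) *
        (f (ha.branchMap (.v n) y) - f (ha.branchMap (.w n) y)) := by
    push_cast
    linear_combination f (ha.branchMap (.w n) y) * hw
  have ha0 := (ha.pos n).le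
  have hd : (0 : ℝ) ≤ dist x y := dist_nonneg
  have hv0 := (ha.branchDeriv_pos (.v n) x).le
  have hw0 := (ha.branchDeriv_pos (.w n) x).le
  have b1 : ‖f (ha.branchMap (.v n) x) - f (ha.branchMap (.v n) y)‖ ≤ K * (3 * a n * dist x y) :=
    (hf _ _).trans (by gcongr; exact ha.dist_branchMap_le (ha.branchDeriv_v_le n) x y)
  have b2 : ‖f (ha.branchMap (.w n) x) - f (ha.branchMap (.w n) y)‖ ≤ K * (3 * a n * dist x y) :=
    (hf _ _).trans (by gcongr; exact ha.dist_branchMap_le (ha.branchDeriv_w_le n) x y)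
  have b3 : ‖f (ha.branchMap (.v n) y) - f (ha.branchMap (.w n) y)‖ ≤ K * (4 * a n) :=
    (hf _ _).trans (by gcongr; exact ha.dist_branchMap_v_w_le n y)
  have c1 := mul_le_mul_of_nonneg_left b1 hv0
  have c2 := mul_le_mul_of_nonneg_left b2 hw0
  have c3 := mul_le_mul (abs_branchDeriv_v_sub_le ha n x y) b3 (norm_nonneg _) (by positivity)
  rw [hid]
  refine (norm_add₃_le).trans ?_
  rw [norm_mul, norm_mul, norm_mul, Complex.norm_of_nonneg hv0, Complex.norm_of_nonneg hw0,
    Complex.norm_real, Real.norm_eq_abs]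
  refine (add_le_add (add_le_add c1 c2) c3).trans ?_
  have e : branchDeriv a 4 (.v n) x * (K * (3 * a n * dist x y)) +
      branchDeriv a 4 (.w n) x * (K * (3 * a n * dist x y)) +
      a n * (4 * Real.pi * (n : ℝ) ^ 4 * dist x y) * (K * (4 * a n)) =
      (12 * a n ^ 2 + 16 * Real.pi * (n : ℝ) ^ 4 * a n ^ 2) * (K * dist x y) := by
    rw [hsum]; ring
  rw [e]
  gcongr
  have p2 : (0 : ℝ) < (n : ℝ) ^ 2 := by positivity
  have h6 : (n : ℝ) ^ 2 ≤ (n : ℝ) ^ 6 := pow_le_pow_right₀ hn (by norm_num)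
  have i1 : a n ^ 2 ≤ 1 / 10000 * (1 / (n : ℝ) ^ 2) := by
    rw [ha.eq, div_pow, one_pow, div_mul_div_comm, one_mul]
    apply one_div_le_one_div_of_le (by positivity)
    calc 10000 * (n : ℝ) ^ 2 ≤ 10000 * (n : ℝ) ^ 6 := by gcongr
      _ = (100 * (n : ℝ) ^ 3) ^ 2 := by ring
  have i2 : (n : ℝ) ^ 4 * a n ^ 2 = 1 / 10000 * (1 / (n : ℝ) ^ 2) := by
    rw [ha.eq]; field_simp; norm_num
  have i3 : 16 * Real.pi * (n : ℝ) ^ 4 * a n ^ 2 =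
      16 * Real.pi * (1 / 10000 * (1 / (n : ℝ) ^ 2)) := by
    rw [← i2]; ring
  rw [i3]
  have hpos : 0 < 1 / 10000 * (1 / (n : ℝ) ^ 2) := by positivity
  -- The constant `63` comes from `12 + 16π < 63`.
  nlinarith [Real.pi_lt_d2]

lemma IsWeight.summable_transfer {f : I → ℂ} {M : ℝ} (hM : ∀ x, ‖f x‖ ≤ M) (x : I) :
    Summable fun b : Branch 4 => (branchDeriv a 4 b x : ℂ) * f (ha.branchMap b x) := by
  refine Summable.of_norm_bounded ((ha.hasSum_branchDeriv x).summable.mul_right M) fun b => ?_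
  rw [norm_mul, Complex.norm_of_nonneg (ha.branchDeriv_pos b x).le]
  exact mul_le_mul_of_nonneg_left (hM _) (ha.branchDeriv_pos b x).le

include ha in
lemma IsWeight.norm_transfer_le {f : I → ℂ} {M : ℝ} (hM : ∀ x, ‖f x‖ ≤ M) (x : I) :
    ‖transfer (intervalMap a 4) f x‖ ≤ M := by
  rw [ha.transfer_eq]
  have h := (ha.hasSum_branchDeriv x).mul_right M
  rw [one_mul] at h
  refine tsum_of_norm_bounded h fun b => ?_
  rw [norm_mul, Complex.norm_of_nonneg (ha.branchDeriv_pos b x).le]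
  exact mul_le_mul_of_nonneg_left (hM _) (ha.branchDeriv_pos b x).le

include ha in
/-- The transfer operator contracts Lipschitz constants. -/
lemma IsWeight.norm_transfer_sub_le {f : I → ℂ} {K M : ℝ} (hK : 0 ≤ K) (hM : ∀ x, ‖f x‖ ≤ M)
    (hf : ∀ x y, ‖f x - f y‖ ≤ K * dist x y) (x y : I) :
    ‖transfer (intervalMap a 4) f x - transfer (intervalMap a 4) f y‖ ≤ K / 2 * dist x y := by
  have hx := ha.summable_transfer hM x
  have hy := ha.summable_transfer hM y
  -- The pairing must precede the triangle inequality, since the cancellation occurs inside each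
  -- pair.
  rw [ha.transfer_eq, ha.transfer_eq, ← hx.tsum_sub hy, tsum_branch (hx.sub hy)]
  refine (norm_add_le _ _).trans ?_
  have hKd : 0 ≤ K * dist x y := mul_nonneg hK dist_nonneg
  have h1 := tsum_of_norm_bounded
    ((hasSum_one_div_pnat_sq.mul_left (63 / 10000)).mul_right (K * dist x y))
    fun n => ha.norm_pair_sub_le hK hf n x y
  have h2 : ∀ j : Fin 4,
      ‖(branchDeriv a 4 (.affine j) x : ℂ) * f (ha.branchMap (.affine j) x) -
        (branchDeriv a 4 (.affine j) y : ℂ) * f (ha.branchMap (.affine j) y)‖ ≤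
      1 / 4 * (K * (1 / 4 * dist x y)) := by
    intro j
    have h : branchDeriv a 4 (.affine j) y = branchDeriv a 4 (.affine j) x := rfl
    rw [h, ← mul_sub, norm_mul, Complex.norm_of_nonneg (ha.branchDeriv_pos _ x).le]
    gcongr
    · exact ha.branchDeriv_le_quarter _ _
    · refine (hf _ _).trans ?_
      gcongr
      exact ha.dist_branchMap_le (ha.branchDeriv_le_quarter _) x y
  have h3 := (norm_sum_le Finset.univ _).trans (Finset.sum_le_sum fun j _ => h2 j)
  rw [Finset.sum_const, Finset.card_univ, Fintype.card_fin, nsmul_eq_mul, Nat.cast_ofNat] at h3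
  refine (add_le_add h1 h3).trans ?_
  -- The pairs give at most `2 · 63/10000` and the affine branches `4 · 1/4 · 1/4`, together less
  -- than `1/2`.
  nlinarith [pi_sq_div_six_le_two]

end Contraction

/-! ### The transfer operator on Lipschitz functions and its spectral gap. -/

section LipOperator

variable {a : ℕ → ℝ} (ha : IsWeight a)

/-- The transfer operator on Lipschitz functions. -/
noncomputable def IsWeight.lipTransfer : Lip →L[ℂ] Lip :=
  LinearMap.mkContinuous
    { toFun := fun f => Lip.ofBound (transfer (intervalMap a 4) f) (lipConst f / 2)
        (div_nonneg (Lip.lipConst_nonneg f) zero_le_two)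
        (ha.norm_transfer_sub_le (Lip.lipConst_nonneg f) f.norm_apply_le f.norm_sub_le)
      map_add' := fun f g => Lip.ext fun x => by
        rw [Lip.add_apply, Lip.ofBound_apply, Lip.ofBound_apply, Lip.ofBound_apply,
          ha.transfer_eq, ha.transfer_eq, ha.transfer_eq,
          ← (ha.summable_transfer f.norm_apply_le x).tsum_add
            (ha.summable_transfer g.norm_apply_le x)]
        exact tsum_congr fun b => by rw [Lip.add_apply, mul_add]
      map_smul' := fun c f => Lip.ext fun x => by
        rw [RingHom.id_apply, Lip.smul_apply, Lip.ofBound_apply, Lip.ofBound_apply,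
          ha.transfer_eq, ha.transfer_eq, ← tsum_mul_left]
        exact tsum_congr fun b => by rw [Lip.smul_apply, mul_left_comm] } 1 fun f => by
    rw [one_mul, Lip.norm_def f]
    refine Lip.norm_le (Lip.lipConst_nonneg f) (ha.norm_transfer_le f.norm_apply_le_iSup)
      fun x y => ?_
    refine (ha.norm_transfer_sub_le (Lip.lipConst_nonneg f) f.norm_apply_le f.norm_sub_le
      x y).trans ?_
    have := Lip.lipConst_nonneg f
    gcongr
    linarith

lemma IsWeight.lipTransfer_apply (f : Lip) (x : I) :
    ha.lipTransfer f x = transfer (intervalMap a 4) f x := rfl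

lemma IsWeight.lipTransfer_one : ha.lipTransfer Lip.one = Lip.one := by
  refine Lip.ext fun x => ?_
  rw [ha.lipTransfer_apply, ha.transfer_eq, Lip.one_apply]
  simp only [Lip.one_apply, mul_one]
  have h : HasSum (fun b : Branch 4 => (branchDeriv a 4 b x : ℂ)) ((1 : ℝ) : ℂ) :=
    Complex.hasSum_ofReal.2 (ha.hasSum_branchDeriv x)
  rw [h.tsum_eq, Complex.ofReal_one]

lemma IsWeight.mean_lipTransfer (f : Lip) : Lip.mean (ha.lipTransfer f) = Lip.mean f :=
  (ha.integrable_transfer f.integrable).2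

lemma IsWeight.norm_pow_le (n : ℕ) :
    ‖(ha.lipTransfer - Lip.mean.smulRight Lip.one) ^ n‖ ≤ 2 * (1 / 2 : ℝ) ^ n := by
  set Q := ha.lipTransfer - Lip.mean.smulRight Lip.one with hQ
  have hQa : ∀ (f : Lip) (x : I), Q f x = transfer (intervalMap a 4) f x - Lip.mean f := by
    intro f x
    have : Q f = ha.lipTransfer f - Lip.mean f • Lip.one := rfl
    rw [this, Lip.sub_apply, Lip.smul_apply, Lip.one_apply, mul_one, ha.lipTransfer_apply]
  have hmean : ∀ f, Lip.mean (Q f) = 0 := by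
    intro f
    have : Q f = ha.lipTransfer f - Lip.mean f • Lip.one := rfl
    rw [this, map_sub, map_smul, ha.mean_lipTransfer, Lip.mean_one, smul_eq_mul, mul_one, sub_self]
  have hlip : ∀ f : Lip, lipConst (Q f) ≤ lipConst f * (1 / 2) := by
    intro f
    refine Lip.lipConst_le (by linarith [Lip.lipConst_nonneg f]) fun x y => ?_
    rw [hQa, hQa, sub_sub_sub_cancel_right]
    refine (ha.norm_transfer_sub_le (Lip.lipConst_nonneg f) f.norm_apply_le f.norm_sub_le
      x y).trans_eq ?_
    ring
  have hpow : ∀ (n : ℕ) (f : Lip), lipConst ((Q ^ n) f) ≤ lipConst f * (1 / 2) ^ n := by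
    intro n
    induction n with
    | zero => intro f; simp
    | succ n ih =>
      intro f
      rw [pow_succ', mul_apply_eq_comp]
      have := hlip ((Q ^ n) f)
      have := ih f
      rw [pow_succ]
      linarith
  refine ContinuousLinearMap.opNorm_le_bound _ (by positivity) fun f => ?_
  -- Only for positive powers is the image of mean zero; the identity is covered by the constant
  -- `2`.
  rcases n with _ | n
  · simp only [pow_zero, one_apply_eq_self]
    linarith [norm_nonneg f]
  · have h1 : Lip.mean ((Q ^ (n + 1)) f) = 0 := by
      rw [pow_succ', mul_apply_eq_comp]
      exact hmean _
    have h2 := Lip.norm_le_of_mean_eq_zero h1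
    have h3 := hpow (n + 1) f
    have h4 := mul_le_mul_of_nonneg_right f.lipConst_le_norm
      (show (0 : ℝ) ≤ (1 / 2) ^ (n + 1) by positivity)
    linarith

lemma IsWeight.spectralGap :
    essSpectralRadius ha.lipTransfer ≤ ENNReal.ofReal (1 / 2) ∧
      Module.End.HasEigenvalue (ha.lipTransfer : Lip →ₗ[ℂ] Lip) 1 ∧
      Module.finrank ℂ (Module.End.maxGenEigenspace (ha.lipTransfer : Lip →ₗ[ℂ] Lip) 1) = 1 ∧
      (∀ z : ℂ, Module.End.HasEigenvalue (ha.lipTransfer : Lip →ₗ[ℂ] Lip) z → ‖z‖ = 1 → z = 1) ∧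
      ∀ z ∈ spectrum ℂ ha.lipTransfer, z = 1 ∨ ‖z‖ ≤ 1 / 2 :=
  spectralGap_of_pow_le (φ := Lip.mean) (e := Lip.one) (by norm_num) (by norm_num) Lip.mean_one
    ha.lipTransfer_one ha.mean_lipTransfer ha.norm_pow_le

end LipOperator

/-! ### Variation of indicator functions of intervals. -/

section Variation

variable {α : Type*} [LinearOrder α]

lemma eVariationOn_sub_le (f g : α → ℂ) (s : Set α) :
    eVariationOn (fun x => f x - g x) s ≤ eVariationOn f s + eVariationOn g s := by
  refine iSup_le fun ⟨n, u, hu, hus⟩ => ?_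
  refine le_trans ?_ (add_le_add (eVariationOn.sum_le (n := n) hu hus)
    (eVariationOn.sum_le (n := n) hu hus))
  rw [← Finset.sum_add_distrib]
  refine Finset.sum_le_sum fun i _ => ?_
  simp only [edist_eq_enorm_sub]
  rw [sub_sub_sub_comm]
  exact enorm_sub_le

lemma eVariationOn_ofReal_le_one {φ : α → ℝ} (hφ : Monotone φ) (h0 : ∀ x, 0 ≤ φ x)
    (h1 : ∀ x, φ x ≤ 1) (s : Set α) : eVariationOn (fun x => (φ x : ℂ)) s ≤ 1 := by
  refine iSup_le fun ⟨n, u, hu, hus⟩ => ?_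
  have he : ∀ i, edist (φ (u (i + 1)) : ℂ) (φ (u i) : ℂ) =
      ENNReal.ofReal (φ (u (i + 1)) - φ (u i)) := fun i => by
    rw [edist_dist, Complex.dist_eq, ← Complex.ofReal_sub, Complex.norm_of_nonneg]
    exact sub_nonneg.2 (hφ (hu i.le_succ))
  simp only [he]
  rw [← ENNReal.ofReal_sum_of_nonneg fun i _ => sub_nonneg.2 (hφ (hu i.le_succ)),
    Finset.sum_range_sub fun i => φ (u i), ← ENNReal.ofReal_one]
  exact ENNReal.ofReal_le_ofReal (by linarith [h0 (u 0), h1 (u n)])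

lemma eVariationOn_indicator_upperSet_le {U : Set α} (hU : IsUpperSet U) (s : Set α) :
    eVariationOn (U.indicator fun _ => (1 : ℂ)) s ≤ 1 := by
  have h : U.indicator (fun _ => (1 : ℂ)) =
      fun x => ((U.indicator (fun _ => (1 : ℝ)) x : ℝ) : ℂ) := by
    funext x
    by_cases hx : x ∈ U <;> simp [hx]
  rw [h]
  refine eVariationOn_ofReal_le_one (fun x y hxy => ?_)
    (fun x => Set.indicator_nonneg (fun _ _ => zero_le_one) x)
    (fun x => Set.indicator_le_self' (fun _ _ => zero_le_one) x) s
  by_cases hx : x ∈ U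
  · simp [hx, hU hxy hx]
  · simp only [hx, not_false_eq_true, Set.indicator_of_notMem]
    exact Set.indicator_nonneg (fun _ _ => zero_le_one) y

/-- The indicator function of an interval has variation at most `2`. -/
lemma eVariationOn_indicator_le {S : Set α} (hS : S.OrdConnected) (s : Set α) :
    eVariationOn (S.indicator fun _ => (1 : ℂ)) s ≤ 2 := by
  -- An interval is its upper closure minus the points beyond it; both are upper sets, whose
  -- indicators are monotone.
  have hU : IsUpperSet {x | ∃ y ∈ S, y ≤ x} := fun x x' hx ⟨y, hy, hyx⟩ => ⟨y, hy, hyx.trans hx⟩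
  have hV : IsUpperSet {x | (∃ y ∈ S, y ≤ x) ∧ x ∉ S} := by
    rintro x x' hx ⟨⟨y, hy, hyx⟩, hxS⟩
    exact ⟨⟨y, hy, hyx.trans hx⟩, fun hx' => hxS (hS.out hy hx' ⟨hyx, hx⟩)⟩
  have h : S.indicator (fun _ => (1 : ℂ)) = fun x =>
      {x | ∃ y ∈ S, y ≤ x}.indicator (fun _ => (1 : ℂ)) x -
        {x | (∃ y ∈ S, y ≤ x) ∧ x ∉ S}.indicator (fun _ => (1 : ℂ)) x := by
    funext x
    by_cases hx : x ∈ S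
    · have : ∃ y ∈ S, y ≤ x := ⟨x, hx, le_rfl⟩
      simp [hx, this, Set.indicator]
    · by_cases hy : ∃ y ∈ S, y ≤ x <;> simp [Set.indicator, hx, hy]
  rw [h, ← one_add_one_eq_two]
  exact (eVariationOn_sub_le _ _ s).trans (add_le_add (eVariationOn_indicator_upperSet_le hU s)
    (eVariationOn_indicator_upperSet_le hV s))

end Variation

lemma bvNorm_indicator_le {S : Set I} (hS : S.OrdConnected) :
    bvNorm (S.indicator fun _ => 1) ≤ 3 := by
  rw [bvNorm, show (3 : ℝ≥0∞) = 1 + 2 by norm_num]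
  refine add_le_add (iSup_le fun x => ?_) (eVariationOn_indicator_le hS _)
  by_cases hx : x ∈ S <;> simp [hx]

lemma essBVNorm_indicator_le {S : Set I} (hS : S.OrdConnected) :
    essBVNorm (S.indicator fun _ => 1) ≤ 3 := by
  rw [essBVNorm, show (3 : ℝ≥0∞) = 1 + 2 by norm_num]
  refine add_le_add ?_ (iInf₂_le_of_le _ Filter.EventuallyEq.rfl (eVariationOn_indicator_le hS _))
  refine (lintegral_mono (g := fun _ => 1) fun x => ?_).trans_eq (by simp)
  by_cases hx : x ∈ S <;> simp [hx]

/-! ### Unboundedness of all powers on functions of bounded variation. -/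

section Unbounded

variable {a : ℕ → ℝ} (ha : IsWeight a)

lemma volume_subtype_Ioo_pos {s t : ℝ} (h0 : 0 ≤ s) (h1 : t ≤ 1) (hst : s < t) :
    0 < volume {x : I | s < x ∧ (x : ℝ) < t} := by
  rw [← volume_image_subtype_coe measurableSet_Ico]
  have h : ((↑) '' {x : I | s < x ∧ (x : ℝ) < t} : Set ℝ) = Set.Ioo s t := by
    ext y
    constructor
    · rintro ⟨x, hx, rfl⟩
      exact hx
    · intro hy
      exact ⟨⟨y, h0.trans hy.1.le, hy.2.trans_le h1⟩, hy, rfl⟩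
  rw [h, Real.volume_Ioo]
  simpa using hst

/-- Shifting by `i` half-periods brings the angle into `(0, π/3)`, where the cosine is at least
`1/2`. -/
lemma half_le_neg_one_pow_mul_cos {i : ℕ} {t : ℝ} (h1 : (i : ℝ) < t) (h2 : t < i + 1 / 3) :
    1 / 2 ≤ (-1) ^ i * Real.cos (Real.pi * t) := by
  have hpi := Real.pi_pos
  have h : Real.cos (Real.pi * t) = (-1) ^ i * Real.cos (Real.pi * (t - i)) := by
    rw [← Real.cos_add_nat_mul_pi]
    congr 1
    ring
  rw [h, ← mul_assoc, ← mul_pow, neg_one_mul, neg_neg, one_pow, one_mul, ← Real.cos_pi_div_three]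
  apply Real.cos_le_cos_of_nonneg_of_le_pi
  · exact mul_nonneg hpi.le (by linarith)
  · linarith
  · nlinarith

include ha in
/-- A function which is almost everywhere equal to a multiple of `v_n'` has large variation. -/
lemma IsWeight.le_eVariationOn {c : ℝ} (hc : 0 < c) (n : ℕ+) {g : I → ℂ}
    (hg : g =ᵐ[volume] fun x => ((c * branchDeriv a 4 (.v n) x : ℝ) : ℂ)) :
    ENNReal.ofReal (c * (3 * n / 100)) ≤ eVariationOn g Set.univ := by
  have hn := one_le_pnat n
  -- The number of half-periods in `[0,1)`: the oscillating term is `cos(π M x)`.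
  set M : ℕ := 4 * (n : ℕ) ^ 4 with hM
  have hMR : (M : ℝ) = 4 * (n : ℝ) ^ 4 := by rw [hM]; push_cast; rfl
  have hM0 : (0 : ℝ) < M := by rw [hMR]; positivity
  -- The first third of each half-period has positive measure, so it contains a point where `g`
  -- takes the prescribed value. Indices from `M` on get an irrelevant default.
  have hex : ∀ i : ℕ, ∃ y : I, i < M → (i : ℝ) < M * y ∧ (M : ℝ) * y < i + 1 / 3 ∧
      g y = ((c * branchDeriv a 4 (.v n) y : ℝ) : ℂ) := by
    intro i
    by_cases hi : i < M
    · have hi' : (i : ℝ) + 1 ≤ M := by exact_mod_cast hi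
      have hpos := volume_subtype_Ioo_pos (s := (i : ℝ) / M) (t := (i + 1 / 3) / M)
        (by positivity) (by rw [div_le_one hM0]; linarith) (by gcongr; linarith)
      obtain ⟨y, ⟨hy1, hy2⟩, hy⟩ :=
        (frequently_ae_mem_iff.2 hpos.ne').and_eventually hg |>.exists
      rw [div_lt_iff₀' hM0] at hy1
      rw [lt_div_iff₀' hM0] at hy2
      exact ⟨y, fun _ => ⟨hy1, hy2, hy⟩⟩
    · exact ⟨⟨0, by simp⟩, fun h => absurd h hi⟩
  choose u hu using hex
  have hM1 : 0 < M := by exact_mod_cast hM0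
  have hmono : MonotoneOn u (Set.Iic (M - 1)) := by
    intro i hi j hj hij
    rcases hij.eq_or_lt with rfl | hlt
    · exact le_rfl
    · simp only [Set.mem_Iic] at hi hj
      have h1 := (hu i (by omega)).2.1
      have h2 := (hu j (by omega)).1
      have h3 : (i : ℝ) + 1 ≤ j := by exact_mod_cast hlt
      have h4 : (M : ℝ) * (u i : ℝ) < M * u j := by linarith
      exact (lt_of_mul_lt_mul_left h4 hM0.le).le
  refine le_trans ?_ (eVariationOn.sum_le_of_monotoneOn_Iic hmono fun i _ => Set.mem_univ _)
  have hterm : ∀ i ∈ Finset.range (M - 1),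
      ENNReal.ofReal (c * a n) ≤ edist (g (u (i + 1))) (g (u i)) := by
    intro i hi
    rw [Finset.mem_range] at hi
    obtain ⟨p1, p2, p3⟩ := hu i (by omega)
    obtain ⟨q1, q2, q3⟩ := hu (i + 1) (by omega)
    have e1 := half_le_neg_one_pow_mul_cos p1 p2
    have e2 := half_le_neg_one_pow_mul_cos q1 q2
    have harg : ∀ y : ℝ, 4 * Real.pi * (n : ℝ) ^ 4 * y = Real.pi * (M * y) := fun y => by
      rw [hMR]; ring
    rw [edist_dist, q3, p3, Complex.dist_eq, ← Complex.ofReal_sub, Complex.norm_real,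
      Real.norm_eq_abs, branchDeriv_v, branchDeriv_v, harg, harg]
    refine ENNReal.ofReal_le_ofReal ?_
    have hca : 0 < c * a n := mul_pos hc (ha.pos n)
    set C1 := Real.cos (Real.pi * (M * (u (i + 1) : ℝ)))
    set C0 := Real.cos (Real.pi * (M * (u i : ℝ)))
    rw [show c * (a n * (2 + C1)) - c * (a n * (2 + C0)) = c * a n * (C1 - C0) by ring, abs_mul,
      abs_of_pos hca]
    refine le_mul_of_one_le_right hca.le ?_
    -- Consecutive cosines have opposite signs and modulus at least `1/2`, so they differ by at
    -- least `1`.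
    have h1 : (-1) ^ (i + 1) * (C1 - C0) = (-1) ^ (i + 1) * C1 + (-1) ^ i * C0 := by ring
    have h2 : |(-1 : ℝ) ^ (i + 1) * (C1 - C0)| = |C1 - C0| := by
      rw [abs_mul, abs_pow, abs_neg, abs_one, one_pow, one_mul]
    rw [← h2, h1]
    exact le_trans (by linarith) (le_abs_self _)
  refine le_trans ?_ (Finset.sum_le_sum hterm)
  rw [Finset.sum_const, Finset.card_range, nsmul_eq_mul, ← ENNReal.ofReal_natCast,
    ← ENNReal.ofReal_mul (Nat.cast_nonneg _)]
  refine ENNReal.ofReal_le_ofReal ?_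
  rw [Nat.cast_pred hM1, hMR]
  -- There are `M - 1 = 4n⁴ - 1 ≥ 3n⁴` jumps, each of size at least `c a_n`.
  have h3 : c * (3 * (n : ℝ) / 100) = 3 * (n : ℝ) ^ 4 * (c * a n) := by
    rw [ha.eq]; field_simp
  rw [h3]
  have h4 : (1 : ℝ) ≤ (n : ℝ) ^ 4 := one_le_pow₀ hn
  have hca : 0 ≤ c * a n := (mul_pos hc (ha.pos n)).le
  gcongr
  linarith

/-- The ranges of the branches are disjoint, so a single term of the sum survives and no
cancellation is possible. -/
lemma IsWeight.transfer_indicator_image (b : Branch 4) (S : Set I) :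
    transfer (intervalMap a 4) ((ha.branchMap b '' S).indicator fun _ => 1) =
      fun x : I => (branchDeriv a 4 b x : ℂ) * S.indicator (fun _ => 1) x := by
  funext x
  rw [ha.transfer_eq, tsum_eq_single b]
  · rw [Set.indicator_image (ha.injective_branchMap b)]
    rfl
  · intro b' hb'
    rw [Set.indicator_of_notMem, mul_zero]
    rintro ⟨y, -, hy⟩
    exact Set.disjoint_left.1 (ha.disjoint_range_branchMap hb') ⟨x, rfl⟩ ⟨y, hy⟩

include ha in
lemma IsWeight.transfer_const_mul (c : ℂ) (f : I → ℂ) :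
    transfer (intervalMap a 4) (fun x => c * f x) =
      fun x => c * transfer (intervalMap a 4) f x := by
  funext x
  rw [ha.transfer_eq, ha.transfer_eq, ← tsum_mul_left]
  exact tsum_congr fun b => mul_left_comm _ _ _

lemma IsWeight.ordConnected_image (b : Branch 4) {S : Set I} (hS : S.OrdConnected) :
    (ha.branchMap b '' S).OrdConnected := by
  have hm := ha.strictMono_branch b
  refine ⟨?_⟩
  rintro _ ⟨s, hs, rfl⟩ _ ⟨t, ht, rfl⟩ z ⟨hz1, hz2⟩
  have h1 := (ha.bijOn_branch b).mapsTo s.2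
  have h2 := (ha.bijOn_branch b).mapsTo t.2
  obtain ⟨r, hr, hrz⟩ := (ha.bijOn_branch b).surjOn
    (show (z : ℝ) ∈ piece a 4 b from ⟨h1.1.trans hz1, lt_of_le_of_lt hz2 h2.2⟩)
  have hz1' : branch a 4 b s ≤ z := hz1
  have hz2' : (z : ℝ) ≤ branch a 4 b t := hz2
  rw [← hrz, hm.le_iff_le] at hz1' hz2'
  exact ⟨⟨r, hr⟩, hS.out hs ht ⟨hz1', hz2'⟩, Subtype.ext hrz⟩

/-- The image of the branch `v n` under the `k`-th iterate of the first affine branch. -/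
noncomputable def IsWeight.nestedPiece {a : ℕ → ℝ} (ha : IsWeight a) (n : ℕ+) : ℕ → Set I
  | 0 => ha.branchMap (.v n) '' Set.univ
  | k + 1 => ha.branchMap (.affine 0) '' ha.nestedPiece n k

lemma IsWeight.ordConnected_nestedPiece (n : ℕ+) (k : ℕ) : (ha.nestedPiece n k).OrdConnected := by
  induction k with
  | zero => exact ha.ordConnected_image _ Set.ordConnected_univ
  | succ k ih => exact ha.ordConnected_image _ ih

/-- Each affine layer is undone by one application of the operator at the cost of its constant
slope; the last application releases `v_n'`. The scalar `c` is kept arbitrary to absorb these slopes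
in the induction. -/
lemma IsWeight.iterate_transfer_nestedPiece (n : ℕ+) (k : ℕ) (c : ℝ) :
    (transfer (intervalMap a 4))^[k + 1]
        (fun x => (c : ℂ) * (ha.nestedPiece n k).indicator (fun _ => 1) x) =
      fun x : I => ((c * ((1 - leftEndJ a) / 4) ^ k * branchDeriv a 4 (.v n) x : ℝ) : ℂ) := by
  induction k generalizing c with
  | zero =>
    rw [zero_add, Function.iterate_one, ha.transfer_const_mul, IsWeight.nestedPiece,
      ha.transfer_indicator_image]
    funext x
    simp
  | succ k ih =>
    rw [Function.iterate_succ_apply, ha.transfer_const_mul, IsWeight.nestedPiece,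
      ha.transfer_indicator_image]
    have h := ih (c * ((1 - leftEndJ a) / 4))
    rw [show (fun x : I => (c : ℂ) * ((branchDeriv a 4 (.affine 0) (x : ℝ) : ℂ) *
      (ha.nestedPiece n k).indicator (fun _ => 1) x)) = fun x : I =>
        ((c * ((1 - leftEndJ a) / 4) : ℝ) : ℂ) *
          (ha.nestedPiece n k).indicator (fun _ => 1) x from ?_, h]
    · funext x
      rw [pow_succ', mul_assoc c]
    · funext x
      simp only [branchDeriv, Nat.cast_ofNat]
      rw [Complex.ofReal_mul, mul_assoc]

include ha in
/-- A norm that is at most `3` on indicator functions of intervals and that dominates the essential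
variation is not preserved by any power of the transfer operator. -/
lemma IsWeight.not_actsContinuously {ν : (I → ℂ) → ℝ≥0∞}
    (h3 : ∀ S : Set I, S.OrdConnected → ν (S.indicator fun _ => 1) ≤ 3)
    (hν : ∀ f, ⨅ (g : I → ℂ) (_ : f =ᵐ[volume] g), eVariationOn g Set.univ ≤ ν f)
    {k : ℕ} (hk : 1 ≤ k) : ¬ ActsContinuously ν (transfer (intervalMap a 4))^[k] := by
  rintro ⟨C, hC⟩
  obtain ⟨k, rfl⟩ := Nat.exists_eq_add_of_le' hk
  have hd : 0 < (1 - leftEndJ a) / 4 := by linarith [ha.leftEndJ_le]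
  set d := (1 - leftEndJ a) / 4 with hdd
  have hbound : ∀ n : ℕ+, d ^ k * (3 * n / 100) ≤ C * 3 := by
    intro n
    have hS := h3 _ (ha.ordConnected_nestedPiece n k)
    have h1 := (hC _ (hS.trans_lt (by norm_num))).trans (mul_le_mul_right hS _)
    have hit := ha.iterate_transfer_nestedPiece n k 1
    simp only [Complex.ofReal_one, one_mul, ← hdd] at hit
    have h2 := (hν _).trans h1
    rw [hit] at h2
    have h4 : ENNReal.ofReal (d ^ k * (3 * n / 100)) ≤ C * 3 :=
      (le_iInf₂ fun g hg => ha.le_eVariationOn (pow_pos hd k) n hg.symm).trans h2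
    have h5 : (C : ℝ≥0∞) * 3 = ENNReal.ofReal (C * 3) := by
      rw [ENNReal.ofReal_mul C.coe_nonneg]
      simp
    rw [h5, ENNReal.ofReal_le_ofReal_iff (by positivity)] at h4
    exact h4
  -- For fixed `k` the lower bound grows linearly in `n`, while the upper bound `3 C` does not
  -- depend on `n`.
  obtain ⟨m, hm⟩ := exists_nat_gt (C * 3 * 100 / (3 * d ^ k))
  have hb := hbound m.succPNat
  have hdk : 0 < d ^ k := pow_pos hd k
  rw [div_lt_iff₀ (by positivity)] at hm
  simp only [Nat.succPNat_coe, Nat.succ_eq_add_one] at hb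
  push_cast at hb
  nlinarith

end Unbounded

end LipGap

theorem theorem1 (a : ℕ → ℝ) (ha : ∀ n : ℕ, 1 ≤ n → a n = 1 / (100 * (n : ℝ) ^ 3))
    (T : I → I) (hT : T = intervalMap a 4) :
    -- `T` is a uniformly expanding Markov map with full branches: the intervals `piece b`
    -- form a partition of `[0,1)`, each is the bijective image of `[0,1)` under an inverse branch
    -- of `T` with the prescribed derivative, and `T'` is bounded below by a constant `κ > 1`.
    (Pairwise fun b b' : Branch 4 => Disjoint (piece a 4 b) (piece a 4 b')) ∧
    (⋃ b : Branch 4, piece a 4 b) = Set.Ico (0 : ℝ) 1 ∧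
    (∀ b : Branch 4, Set.BijOn (branch a 4 b) (Set.Ico (0 : ℝ) 1) (piece a 4 b)) ∧
    (∀ (b : Branch 4) (x : ℝ), HasDerivAt (branch a 4 b) (branchDeriv a 4 b x) x) ∧
    (∀ (b : Branch 4) (x y : I), (y : ℝ) = branch a 4 b x → T y = x) ∧
    (∃ κ : ℝ, 1 < κ ∧ ∀ y : I, κ ≤ rightDeriv T y) ∧
    -- `T` preserves Lebesgue measure, and `transfer T` is its transfer operator.
    MeasurePreserving T volume volume ∧
    (∀ f : I → ℂ, Integrable f → Integrable (transfer T f) ∧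
      ∀ g : I → ℂ, Measurable g → (∃ C : ℝ, ∀ x, ‖g x‖ ≤ C) →
        ∫ x, f x * g (T x) = ∫ x, transfer T f x * g x) ∧
    -- Spectral gap on Lipschitz functions.
    (∃ L : Lip →L[ℂ] Lip, (∀ (f : Lip) (x : I), L f x = transfer T f x) ∧
      essSpectralRadius L ≤ 3 / 4 ∧
      Module.End.HasEigenvalue (L : Lip →ₗ[ℂ] Lip) 1 ∧
      Module.finrank ℂ (Module.End.maxGenEigenspace (L : Lip →ₗ[ℂ] Lip) 1) = 1 ∧
      (∀ z : ℂ, Module.End.HasEigenvalue (L : Lip →ₗ[ℂ] Lip) z → ‖z‖ = 1 → z = 1) ∧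
      ∃ r : ℝ, r < 1 ∧ ∀ z ∈ spectrum ℂ L, z = 1 ∨ ‖z‖ ≤ r) ∧
    -- No power acts continuously on functions of bounded variation.
    (∀ k : ℕ, 1 ≤ k → ¬ ActsContinuously bvNorm (transfer T)^[k] ∧
      ¬ ActsContinuously essBVNorm (transfer T)^[k]) := by
  have hw : IsWeight a := ha
  subst hT
  obtain ⟨h1, h2, h3, h4, h5⟩ := hw.spectralGap
  refine ⟨hw.disjoint_piece, hw.iUnion_piece, hw.bijOn_branch, hasDerivAt_branch a 4,
    fun b x y h => hw.intervalMap_eq h, ⟨4, by norm_num, fun y => ?_⟩, hw.measurePreserving,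
    fun f hf => ⟨(hw.integrable_transfer hf).1, fun g hg hb => hw.integral_mul_comp hf hg hb⟩,
    ⟨hw.lipTransfer, hw.lipTransfer_apply, h1.trans ?_, h2, h3, h4, 1 / 2, by norm_num, h5⟩,
    fun k hk => ⟨hw.not_actsContinuously (fun S hS => bvNorm_indicator_le hS) (fun f => ?_) hk,
      hw.not_actsContinuously (fun S hS => essBVNorm_indicator_le hS)
        (fun f => le_add_left le_rfl) hk⟩⟩
  · obtain ⟨b, x, rfl⟩ := hw.exists_branchMap_eq y
    rw [hw.rightDeriv_branchMap, le_inv_comm₀ (by norm_num) (hw.branchDeriv_pos b x)]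
    linarith [hw.branchDeriv_le_quarter b x]
  · rw [ENNReal.le_div_iff_mul_le (by norm_num) (by norm_num),
      show (4 : ℝ≥0∞) = ENNReal.ofReal 4 by norm_num, ← ENNReal.ofReal_mul (by norm_num),
      show (3 : ℝ≥0∞) = ENNReal.ofReal 3 by norm_num]
    exact ENNReal.ofReal_le_ofReal (by norm_num)
  -- The function is one of its own representatives, so its variation bounds the essential
  -- variation.
  · exact (iInf₂_le f Filter.EventuallyEq.rfl).trans (le_add_left le_rfl)
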